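/- Let $C$ be a finite set of candidates partitioned into a set $\mathcal{P}=\{P_1,\dots,P_k\}$ of (nonempty) parties, and let $V$ be a finite set of voters, each voter $v$ having a strict total preference order $\succ_v$ over $C$. A nomination scheme is a tuple $(c_1,\dots,c_k)$ with $c_i\in P_i$ for all $i$. In the resulting reduced election each voter votes for her favourite candidate among $c_1,\dots,c_k$; the score of a nominee is the number of votes it gets, and party $P_i$ is a winner if no nominee has a higher score than $c_i$ (ties allowed). The profile $(\succ_v)_{v\in V}$ is party-aligned single-peaked if there is a strict total order $\triangleleft_{\mathcal{P}}$ on $\mathcal{P}$ such that for every voter $v$ there is a strict total order $\triangleleft_v$ on $C$ for which (i) $a\triangleleft_v b\triangleleft_v c$ and $a\succ_v b$ imply $b\succ_v c$, for all $a,b,c\in C$, and (ii) for $a\in P$ and $b\in Q$ with $P\neq Q$, $a\triangleleft_v b$ implies $P\triangleleft_{\mathcal{P}} Q$. **Theorem.** Restricted to inputs $(C,\mathcal{P},P,V,(\succ_v)_{v\in V})$ with $P\in\mathcal{P}$ whose profile is party-aligned single-peaked (the axes not being part of the input), each of the following two decision problems is solvable in polynomial time, that is, by a Turing machine that on every such input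 halts with the correct answer after a number of steps bounded by a polynomial in the length of the input, where the input is written as a string listing the distinguished party, the party of each candidate and the full ballot of each voter, with candidates and parties numbered in binary: 1. *Possible President*: is $P$ a winner in the reduced election of some nomination scheme? 2. *Necessary President*: is $P$ a winner in the reduced election of every nomination scheme? -/

import Mathlib

/-- Candidates `C` partitioned into parties `𝓟` (given by the map sending a candidate to its party;
surjectivity says that every party is a nonempty block), and voters `V`, each with a strict
preference order over the candidates. -/
structure Election (C 𝓟 V : Type) where
  /-- the party that a candidate belongs to -/
  party : C → 𝓟
  party_surjective : Function.Surjective party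
  /-- `prefers v a b` : voter `v` strictly prefers `a` to `b` -/
  prefers : V → C → C → Prop
  prefers_strict : ∀ v, IsStrictTotalOrder C (prefers v)

namespace Election

variable {C 𝓟 V : Type}

/-- The strict order `pref` is single-peaked with respect to the axis `ax`. -/
def SinglePeakedWrt (pref ax : C → C → Prop) : Prop :=
  ∀ a b c, ax a b → ax b c → pref a b → pref b c

/-- A candidate axis `ax` is compatible with a party axis `partyAx`. -/
def Compatible (E : Election C 𝓟 V) (ax : C → C → Prop) (partyAx : 𝓟 → 𝓟 → Prop) : Prop :=
  ∀ a b, E.party a ≠ E.party b → ax a b → partyAx (E.party a) (E.party b)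

/-- Party-aligned single-peakedness: there is one party axis such that every voter has a perceived
axis over the candidates that is compatible with it and makes the voter's order single-peaked. -/
def PartyAlignedSinglePeaked (E : Election C 𝓟 V) : Prop :=
  ∃ partyAx : 𝓟 → 𝓟 → Prop, IsStrictTotalOrder 𝓟 partyAx ∧
    ∀ v, ∃ ax : C → C → Prop, IsStrictTotalOrder C ax ∧
      SinglePeakedWrt (E.prefers v) ax ∧ E.Compatible ax partyAx

/-- A nomination scheme picks one candidate from each party. -/
def NominationScheme (E : Election C 𝓟 V) : Type :=
  {s : 𝓟 → C // ∀ P, E.party (s P) = P}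

/-- In the reduced election over the nominees of `s`, voter `v` votes for the nominee of `P`, i.e.
this nominee is the favourite of `v` among all nominees. -/
def VotesFor (E : Election C 𝓟 V) (s : E.NominationScheme) (v : V) (P : 𝓟) : Prop :=
  ∀ Q, Q ≠ P → E.prefers v (s.1 P) (s.1 Q)

/-- The Plurality score of the nominee of `P` in the reduced election. -/
noncomputable def score (E : Election C 𝓟 V) (s : E.NominationScheme) (P : 𝓟) : ℕ :=
  {v | E.VotesFor s v P}.ncard

/-- `P` is a (possibly tied) winner of the reduced election. -/
def IsWinner (E : Election C 𝓟 V) (s : E.NominationScheme) (P : 𝓟) : Prop :=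
  ∀ Q, E.score s Q ≤ E.score s P

/-- `P` wins under some nomination scheme. -/
def IsPossiblePresident (E : Election C 𝓟 V) (P : 𝓟) : Prop :=
  ∃ s : E.NominationScheme, E.IsWinner s P

/-- `P` wins under all nomination schemes. -/
def IsNecessaryPresident (E : Election C 𝓟 V) (P : 𝓟) : Prop :=
  ∀ s : E.NominationScheme, E.IsWinner s P

end Election

/-- An input of the two president problems, with candidates, parties and voters numbered from `0`:
the party of each candidate, the distinguished party, and the ballots. -/
structure PresidentInput where
  numCandidates : ℕ
  numParties : ℕ
  numVoters : ℕ
  party : Fin numCandidates → Fin numParties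
  party_surjective : Function.Surjective party
  distinguished : Fin numParties
  /-- `ballot v i` is the candidate in position `i` (position `0` is the best) in the order of `v` -/
  ballot : Fin numVoters → Equiv.Perm (Fin numCandidates)

namespace PresidentInput

open Computability

/-- The election described by the input: `v` prefers `a` to `b` if `a` stands before `b` on the
ballot of `v`. -/
def election (I : PresidentInput) :
    Election (Fin I.numCandidates) (Fin I.numParties) (Fin I.numVoters) where
  party := I.party
  party_surjective := I.party_surjective
  prefers v a b := (I.ballot v).symm a < (I.ballot v).symm b
  prefers_strict v :=
    { trichotomous := fun _ _ h₁ h₂ =>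
        (I.ballot v).symm.injective (le_antisymm (not_lt.mp h₂) (not_lt.mp h₁))
      irrefl := fun _ => lt_irrefl _
      trans := fun _ _ _ => lt_trans }

/-- A natural number in binary, terminated by a comma. -/
def encodeNumber (n : ℕ) : List Γ' :=
  encodingNatΓ'.encode n ++ [Γ'.comma]

/-- The input as a string: the distinguished party, then each candidate followed by its party, then
the separator `bra`, then for each voter the candidates in decreasing order of preference, with
each ballot terminated by `ket`. All numbers are written in binary. -/
def encode (I : PresidentInput) : List Γ' :=
  encodeNumber I.distinguished
    ++ (List.finRange I.numCandidates).flatMap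
        (fun c : Fin I.numCandidates => encodeNumber c ++ encodeNumber (I.party c))
    ++ [Γ'.bra]
    ++ (List.finRange I.numVoters).flatMap
        (fun v => (List.finRange I.numCandidates).flatMap (fun i => encodeNumber (I.ballot v i))
          ++ [Γ'.ket])

end PresidentInput

/-- The decision problem `p`, restricted to the inputs in the domain `D`, is solvable in polynomial
time: there are a Turing machine (Mathlib's multi-stack machine with finite control) and a
polynomial `q` such that on the string `enc a` of every `a` in `D` the machine halts within
`q (length of enc a)` steps and its output is the truth value of `p a`. -/
def PolyTimeSolvableOn {α Γ : Type} (enc : α → List Γ) (D p : α → Prop) : Prop :=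
  ∃ f : {a // D a} → Bool, (∀ a, f a = true ↔ p a.1) ∧
    Nonempty (Turing.TM2ComputableInPolyTime (fun a : {a // D a} => enc a.1)
      Computability.encodeBool f)

/-! Enumerate the parties along a common axis. Restricted to candidates of three different parties,
no voter puts the middle one last, although the voters' axes inside a party may differ. Hence a
voter who prefers a nominee to those of the adjacent parties prefers it to every candidate of every
farther party (`IsAxis.supports`): a score is determined by the nominee and its at most two
neighbours.

The axis is unknown, so votes are counted in a way that does not mention it. For a list `S` of
nominees, `Supports S v x` says that `v` ranks `x` above everything that can still be nominated
together with `S`. If `x` is in `S`, its supporters vote for it under every scheme containing `S`,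
so their number is always a lower bound for its score; it is the exact score once `S` contains the
neighbours of `x`. Dually, `Beats` gives an upper bound, exact under the same condition.

Necessary President fails iff some nominee `x` of the party and five further candidates, namely a
rival and the neighbours of both, certify that the rival outscores `x`. Any such certificate is
sound without reference to the axis, so trying all tuples of constant length suffices
(`not_isNecessaryPresident_iff`).

For Possible President, guess `x` and its neighbours `t`, and let `B` be the number of supporters of
`x` relative to `x :: t`. With a known axis, one would look for a walk along it in which every three
consecutive nominees are compatible with `x :: t` and have at most `B` supporters. Instead,
`Extendable` asks that a pair can be continued whatever party comes next. This is enough, since the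
party sequence may be taken to be the true axis. It is also necessary: if the guess comes from a
winning scheme, its own nominees answer every request, because supporter counts for arbitrary
triples are still lower bounds for scores (`isPossiblePresident_iff`). The surviving pairs are found
by filtering the set of all pairs repeatedly, at least once for each party.

For the running time, structured stack programs compile step by step into a Turing machine
(`Cmd.exists_iterate_step`). Programs on prefix codes of binary trees then give a class `PolyFun` of
functions closed under composition, pairing, branching and folds whose state grows by a bounded
amount per round. Both algorithms and the decoder lie in this class. -/

/-! ### Structured programs on stacks and their compilation to stack Turing machines -/

/-- Structured programs acting on finitely many stacks: `pop k c` pops from the stack `k` and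
branches on the result, and `loop k c` keeps popping from `k` and running `c` on the popped symbol
until `k` is empty. -/
inductive Cmd {K : Type} (Γ : K → Type) : Type
  | skip : Cmd Γ
  | push (k : K) (s : Γ k) : Cmd Γ
  | pop (k : K) (c : Option (Γ k) → Cmd Γ) : Cmd Γ
  | seq (c₁ c₂ : Cmd Γ) : Cmd Γ
  | loop (k : K) (c : Γ k → Cmd Γ) : Cmd Γ

namespace Cmd

open Turing Function

variable {K : Type} {Γ : K → Type}

/-- `Exec c S S' t`: the program `c` started on the stacks `S` ends on the stacks `S'` after `t`
elementary steps. -/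
inductive Exec [DecidableEq K] :
    Cmd Γ → (∀ k, List (Γ k)) → (∀ k, List (Γ k)) → ℕ → Prop
  | skip (S) : Exec .skip S S 1
  | push (k s S) : Exec (.push k s) S (update S k (s :: S k)) 1
  | pop {k c S S' t} (h : Exec (c (S k).head?) (update S k (S k).tail) S' t) :
      Exec (.pop k c) S S' (t + 1)
  | seq {c₁ c₂ S S' S'' t₁ t₂} (h₁ : Exec c₁ S S' t₁) (h₂ : Exec c₂ S' S'' t₂) :
      Exec (.seq c₁ c₂) S S'' (t₁ + t₂)
  | loop_nil {k c S} (h : S k = []) : Exec (.loop k c) S S 1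
  | loop_cons {k c S S' S'' a l t₁ t₂} (h : S k = a :: l)
      (h₁ : Exec (c a) (update S k l) S' t₁) (h₂ : Exec (.loop k c) S' S'' t₂) :
      Exec (.loop k c) S S'' (t₁ + t₂ + 1)

/-- The labels of the machine code of a program. -/
def Lab : Cmd Γ → Type
  | skip => Unit
  | push _ _ => Unit
  | pop _ c => Option (Σ o, Lab (c o))
  | seq c₁ c₂ => Lab c₁ ⊕ Lab c₂
  | loop _ c => Option (Σ a, Lab (c a))

/-- The label at which the machine code of a program starts. -/
def entry : (c : Cmd Γ) → Lab c
  | skip => ()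
  | push _ _ => ()
  | pop _ _ => none
  | seq c₁ _ => Sum.inl (entry c₁)
  | loop _ _ => none

theorem finite_lab [∀ k, Finite (Γ k)] (c : Cmd Γ) : Finite (Lab c) := by
  induction c with
  | skip => exact inferInstanceAs (Finite Unit)
  | push k s => exact inferInstanceAs (Finite Unit)
  | pop k c ih => exact inferInstanceAs (Finite (Option (Σ o, Lab (c o))))
  | seq c₁ c₂ ih₁ ih₂ => exact inferInstanceAs (Finite (Lab c₁ ⊕ Lab c₂))
  | loop k c ih => exact inferInstanceAs (Finite (Option (Σ a, Lab (c a))))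

variable [DecidableEq K]

/-- The machine code of a program, with labels renamed by `f` and leaving to the label `exit`. The
register of the machine keeps the last symbol popped from each stack. -/
def code {L : Type} : (c : Cmd Γ) → (Lab c → L) → L → Lab c → TM2.Stmt Γ L (∀ k, Option (Γ k))
  | skip, _, exit, _ => .goto fun _ => exit
  | push k s, _, exit, _ => .push k (fun _ => s) (.goto fun _ => exit)
  | pop k c, f, _, none => .pop k (fun v o => update v k o)
      (.goto fun v => f (some ⟨v k, entry (c (v k))⟩))
  | pop _ c, f, exit, some ⟨o, l⟩ => code (c o) (fun l => f (some ⟨o, l⟩)) exit l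
  | seq c₁ c₂, f, _, Sum.inl l => code c₁ (fun l => f (Sum.inl l)) (f (Sum.inr (entry c₂))) l
  | seq _ c₂, f, exit, Sum.inr l => code c₂ (fun l => f (Sum.inr l)) exit l
  | loop k c, f, exit, none => .pop k (fun v o => update v k o)
      (.goto fun v => (v k).elim exit fun a => f (some ⟨a, entry (c a)⟩))
  | loop _ c, f, _, some ⟨a, l⟩ => code (c a) (fun l => f (some ⟨a, l⟩)) (f none) l

/-- Induction works because the ambient machine `m`, the embedding `f` of the labels and the exit
label are arbitrary: a subprogram is then just a program sitting inside a larger machine. -/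
theorem exists_iterate_step {c : Cmd Γ} {S S' : ∀ k, List (Γ k)} {t : ℕ} (h : Exec c S S' t) :
    ∀ {L : Type} (m : L → TM2.Stmt Γ L (∀ k, Option (Γ k))) (f : Lab c → L) (exit : L),
      (∀ l, m (f l) = code c f exit l) → ∀ v, ∃ v',
        (flip bind (TM2.step m))^[t] (some ⟨some (f (entry c)), v, S⟩) =
          some ⟨some exit, v', S'⟩ := by
  induction h with
  | skip S =>
    intro L m f exit hm v
    refine ⟨v, ?_⟩
    have := hm ()
    simp [flip, this, entry, code]
  | push k s S =>
    intro L m f exit hm v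
    refine ⟨v, ?_⟩
    have := hm ()
    simp [flip, this, entry, code]
  | @pop k c S S' t h ih =>
    intro L m f exit hm v
    obtain ⟨v', hv'⟩ := ih m (fun l => f (some ⟨_, l⟩)) exit (fun l => hm (some ⟨_, l⟩))
      (update v k (S k).head?)
    refine ⟨v', ?_⟩
    rw [iterate_succ_apply, ← hv']
    congr 1
    have := hm none
    simp only [flip, entry, this, code, Option.bind_eq_bind, Option.bind_some, TM2.step,
      TM2.stepAux]
    exact congrArg (fun o => some (TM2.Cfg.mk (some (f (some ⟨o, entry (c o)⟩)))
      (update v k (S k).head?) (update S k (S k).tail))) (update_self ..)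
  | @seq c₁ c₂ S S' S'' t₁ t₂ h₁ h₂ ih₁ ih₂ =>
    intro L m f exit hm v
    obtain ⟨v', hv'⟩ := ih₁ m (fun l => f (Sum.inl l)) _ (fun l => hm (Sum.inl l)) v
    obtain ⟨v'', hv''⟩ := ih₂ m (fun l => f (Sum.inr l)) exit (fun l => hm (Sum.inr l)) v'
    refine ⟨v'', ?_⟩
    rw [add_comm, iterate_add_apply]
    erw [hv']
    exact hv''
  | @loop_nil k c S h =>
    intro L m f exit hm v
    refine ⟨update v k none, ?_⟩
    have := hm none
    have hS : update S k [] = S := by rw [← h, update_eq_self]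
    simp [flip, entry, this, code, h, hS]
  | @loop_cons k c S S' S'' a l t₁ t₂ h h₁ h₂ ih₁ ih₂ =>
    intro L m f exit hm v
    obtain ⟨v', hv'⟩ := ih₁ m (fun l => f (some ⟨a, l⟩)) (f none) (fun l => hm (some ⟨a, l⟩))
      (update v k (some a))
    obtain ⟨v'', hv''⟩ := ih₂ m f exit hm v'
    refine ⟨v'', ?_⟩
    have := hm none
    rw [iterate_succ_apply, add_comm, iterate_add_apply, ← hv'']
    congr 1
    refine Eq.trans ?_ hv'
    congr 1
    simp [flip, entry, this, code, h]

/-- The machine running the program `c` and halting at its end, with input stack `k₀` and output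
stack `k₁`. -/
noncomputable def machine [Fintype K] [∀ k, Fintype (Γ k)] (k₀ k₁ : K) (c : Cmd Γ) : FinTM2 where
  K := K
  k₀ := k₀
  k₁ := k₁
  Γ := Γ
  Λ := Option (Lab c)
  main := some (entry c)
  ΛFin := @instFintypeOption _ (@Fintype.ofFinite _ (finite_lab c))
  σ := ∀ k, Option (Γ k)
  initialState := fun _ => none
  -- The last step clears the register, because a halting configuration in the sense of `haltList`
  -- carries the initial register state.
  m := fun l => l.elim (.load (fun _ _ => none) .halt) (code c some none)

/-- The left side is the form in which `initList` and `haltList` describe the stacks. -/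
theorem dite_eq_update (k₀ : K) (w : List (Γ k₀)) :
    (fun k => @dite (List (Γ k)) (k = k₀) (inferInstance : Decidable (k = k₀))
      (fun h => by rw [h]; exact w) fun _ => []) = update (fun _ => []) k₀ w := by
  funext k
  by_cases hk : k = k₀
  · subst hk
    simp
  · simp [hk]

theorem outputs_of_exec [Fintype K] [∀ k, Fintype (Γ k)] {k₀ k₁ : K} {c : Cmd Γ}
    {w : List (Γ k₀)} {u : List (Γ k₁)} {t n : ℕ}
    (h : Exec c (update (fun _ => []) k₀ w) (update (fun _ => []) k₁ u) t) (hn : t + 1 ≤ n) :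
    Nonempty (TM2OutputsInTime (machine k₀ k₁ c) w (some u) n) := by
  obtain ⟨v', hv'⟩ := exists_iterate_step h (machine k₀ k₁ c).m some none (fun l => rfl)
    (fun _ => none)
  refine ⟨⟨⟨t + 1, ?_⟩, hn⟩⟩
  have h₀ : initList (machine k₀ k₁ c) w =
      ⟨some (some (entry c)), fun _ => none, update (fun _ => []) k₀ w⟩ := by
    exact congrArg (TM2.Cfg.mk _ _) (dite_eq_update _ _)
  have h₁ : haltList (machine k₀ k₁ c) u =
      ⟨none, fun _ => none, update (fun _ => []) k₁ u⟩ := by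
    exact congrArg (TM2.Cfg.mk _ _) (dite_eq_update _ _)
  rw [iterate_succ_apply', h₀]
  erw [hv']
  exact congrArg some h₁.symm

end Cmd

/-! ### Programs computing with binary trees -/

/-- Binary trees, the values that the programs compute with. -/
inductive Tree₂ : Type
  | nil : Tree₂
  | cons (a b : Tree₂) : Tree₂

namespace Tree₂

/-- The prefix code of a tree. -/
def code : Tree₂ → List Bool
  | nil => [false]
  | cons a b => true :: (code a ++ code b)

/-- The length of the prefix code of a tree. -/
def size (d : Tree₂) : ℕ := d.code.length

@[simp] theorem size_nil : size nil = 1 := rfl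

@[simp] theorem size_cons (a b : Tree₂) : size (cons a b) = size a + size b + 1 := by
  simp [size, code]

@[simp] theorem length_code (d : Tree₂) : d.code.length = d.size := rfl

end Tree₂

/-- The stacks of the tree machine: the input, the main stack `A` and three auxiliary stacks. -/
inductive Stk : Type
  | inp | A | B | C | N

instance : DecidableEq Stk := fun a b => by
  cases a <;> cases b <;> first | exact isTrue rfl | exact isFalse (by simp)

instance : Fintype Stk where
  elems := {.inp, .A, .B, .C, .N}
  complete k := by cases k <;> simp

namespace Stk

open Computability Function Cmd

/-- The stack alphabets of the tree machine. -/
@[reducible] def Alph : Stk → Type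
  | inp => Γ'
  | A => Bool
  | B => Bool
  | C => Bool
  | N => Bool

instance (k : Stk) : Fintype (Alph k) := by
  cases k <;> infer_instance

/-- The stacks with the given contents. -/
def conf (i : List Γ') (a b c n : List Bool) : ∀ k, List (Alph k)
  | inp => i
  | A => a
  | B => b
  | C => c
  | N => n

variable {i : List Γ'} {a b c n : List Bool}

theorem update_inp (x : List Γ') : update (conf i a b c n) inp x = conf x a b c n := by
  funext k; cases k <;> rfl

theorem update_A (x : List Bool) : update (conf i a b c n) A x = conf i x b c n := by
  funext k; cases k <;> rfl

theorem update_B (x : List Bool) : update (conf i a b c n) B x = conf i a x c n := by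
  funext k; cases k <;> rfl

theorem update_C (x : List Bool) : update (conf i a b c n) C x = conf i a b x n := by
  funext k; cases k <;> rfl

theorem update_N (x : List Bool) : update (conf i a b c n) N x = conf i a b c x := by
  funext k; cases k <;> rfl

/-- Execution of a program within a given number of steps. -/
def Runs (c : Cmd Alph) (S S' : ∀ k, List (Alph k)) (T : ℕ) : Prop := ∃ t ≤ T, Exec c S S' t

variable {S S' S'' : ∀ k, List (Alph k)} {T T' : ℕ}

theorem Runs.mono {c : Cmd Alph} (h : Runs c S S' T) (hT : T ≤ T') : Runs c S S' T' := by
  obtain ⟨t, ht, h⟩ := h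
  exact ⟨t, ht.trans hT, h⟩

theorem Runs.seq {c₁ c₂ : Cmd Alph} (h₁ : Runs c₁ S S' T) (h₂ : Runs c₂ S' S'' T') :
    Runs (.seq c₁ c₂) S S'' (T + T') := by
  obtain ⟨t₁, ht₁, h₁⟩ := h₁
  obtain ⟨t₂, ht₂, h₂⟩ := h₂
  exact ⟨_, add_le_add ht₁ ht₂, .seq h₁ h₂⟩

theorem runs_skip : Runs .skip S S 1 := ⟨1, le_rfl, .skip _⟩

theorem runs_push_A (s : Bool) : Runs (.push A s) (conf i a b c n) (conf i (s :: a) b c n) 1 :=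
  ⟨1, le_rfl, by
    have h := Exec.push A s (conf i a b c n)
    rw [update_A] at h
    exact h⟩

theorem runs_push_B (s : Bool) : Runs (.push B s) (conf i a b c n) (conf i a (s :: b) c n) 1 :=
  ⟨1, le_rfl, by
    have h := Exec.push B s (conf i a b c n)
    rw [update_B] at h
    exact h⟩

theorem runs_push_C (s : Bool) : Runs (.push C s) (conf i a b c n) (conf i a b (s :: c) n) 1 :=
  ⟨1, le_rfl, by
    have h := Exec.push C s (conf i a b c n)
    rw [update_C] at h
    exact h⟩

theorem runs_push_N (s : Bool) : Runs (.push N s) (conf i a b c n) (conf i a b c (s :: n)) 1 :=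
  ⟨1, le_rfl, by
    have h := Exec.push N s (conf i a b c n)
    rw [update_N] at h
    exact h⟩

theorem runs_pop_A {s : Bool} {f : Option Bool → Cmd Alph}
    (h : Runs (f (some s)) (conf i a b c n) S' T) :
    Runs (.pop A f) (conf i (s :: a) b c n) S' (T + 1) := by
  obtain ⟨t, ht, h⟩ := h
  refine ⟨t + 1, by lia, .pop ?_⟩
  rw [update_A]
  exact h

theorem runs_loop_nil {k : Stk} {f : Alph k → Cmd Alph} (h : S k = []) :
    Runs (.loop k f) S S 1 := ⟨1, le_rfl, .loop_nil h⟩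

theorem runs_loop_inp {s : Γ'} {f : Γ' → Cmd Alph} (h₁ : Runs (f s) (conf i a b c n) S' T)
    (h₂ : Runs (.loop inp f) S' S'' T') :
    Runs (.loop inp f) (conf (s :: i) a b c n) S'' (T + T' + 1) := by
  obtain ⟨t₁, ht₁, h₁⟩ := h₁
  obtain ⟨t₂, ht₂, h₂⟩ := h₂
  refine ⟨t₁ + t₂ + 1, by lia, .loop_cons (a := s) (l := i) rfl ?_ h₂⟩
  rw [update_inp]
  exact h₁

theorem runs_loop_B {s : Bool} {f : Bool → Cmd Alph} (h₁ : Runs (f s) (conf i a b c n) S' T)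
    (h₂ : Runs (.loop B f) S' S'' T') :
    Runs (.loop B f) (conf i a (s :: b) c n) S'' (T + T' + 1) := by
  obtain ⟨t₁, ht₁, h₁⟩ := h₁
  obtain ⟨t₂, ht₂, h₂⟩ := h₂
  refine ⟨t₁ + t₂ + 1, by lia, .loop_cons (a := s) (l := b) rfl ?_ h₂⟩
  rw [update_B]
  exact h₁

theorem runs_loop_C {s : Bool} {f : Bool → Cmd Alph} (h₁ : Runs (f s) (conf i a b c n) S' T)
    (h₂ : Runs (.loop C f) S' S'' T') :
    Runs (.loop C f) (conf i a b (s :: c) n) S'' (T + T' + 1) := by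
  obtain ⟨t₁, ht₁, h₁⟩ := h₁
  obtain ⟨t₂, ht₂, h₂⟩ := h₂
  refine ⟨t₁ + t₂ + 1, by lia, .loop_cons (a := s) (l := c) rfl ?_ h₂⟩
  rw [update_C]
  exact h₁

theorem runs_loop_N {s : Bool} {f : Bool → Cmd Alph} (h₁ : Runs (f s) (conf i a b c n) S' T)
    (h₂ : Runs (.loop N f) S' S'' T') :
    Runs (.loop N f) (conf i a b c (s :: n)) S'' (T + T' + 1) := by
  obtain ⟨t₁, ht₁, h₁⟩ := h₁
  obtain ⟨t₂, ht₂, h₂⟩ := h₂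
  refine ⟨t₁ + t₂ + 1, by lia, .loop_cons (a := s) (l := n) rfl ?_ h₂⟩
  rw [update_N]
  exact h₁

/-- Push a symbol on `A`. -/
abbrev pushA (s : Bool) : Cmd Alph := .push A s

/-- Push a symbol on `B`. -/
abbrev pushB (s : Bool) : Cmd Alph := .push B s

/-- Push a symbol on `C`. -/
abbrev pushC (s : Bool) : Cmd Alph := .push C s

/-- The step of the loop moving a tree from `A` to the stack reached by `out`, with one symbol on
`N` for each pending subtree. -/
def moveStep (out : Bool → Cmd Alph) : Cmd Alph :=
  .pop A fun
    | none => .skip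
    | some true => .seq (out true) (.seq (.push N true) (.push N true))
    | some false => out false

/-- Move a tree from `A` to the stack reached by `out`. -/
def moveTree (out : Bool → Cmd Alph) : Cmd Alph :=
  .seq (.push N true) (.loop N fun _ => moveStep out)

/-- The symbols on `N` count the subtrees still to be moved: a leaf consumes one, an inner node
consumes one and adds two. The continuation form of the statement lets the two subtrees be handled
in turn inside a single loop. Each symbol costs at most five steps: the loop test, the pop and up to
three pushes. -/
theorem runs_loop_moveStep_B (d : Tree₂) : ∀ {a b n T},
    Runs (.loop N fun _ => moveStep pushB) (conf i a (d.code.reverse ++ b) c n) S' T →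
      Runs (.loop N fun _ => moveStep pushB) (conf i (d.code ++ a) b c (true :: n)) S'
        (T + 5 * d.size) := by
  induction d with
  | nil =>
    intro a b n T h
    exact (runs_loop_N (runs_pop_A (runs_push_B false)) h).mono (by simp; lia)
  | cons l r ihl ihr =>
    intro a b n T h
    have h' := ihl (a := r.code ++ a) (b := true :: b) (n := true :: n) (ihr (T := T) (by
      simpa [Tree₂.code] using h))
    have h'' := runs_loop_N (s := true) (n := n) (f := fun _ => moveStep pushB)
      (runs_pop_A (s := true) ((runs_push_B true).seq
        ((runs_push_N true).seq (runs_push_N true)))) h'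
    simp only [Tree₂.code, List.cons_append, List.append_assoc]
    exact h''.mono (by simp; lia)

theorem runs_loop_moveStep_C (d : Tree₂) : ∀ {a c n T},
    Runs (.loop N fun _ => moveStep pushC) (conf i a b (d.code.reverse ++ c) n) S' T →
      Runs (.loop N fun _ => moveStep pushC) (conf i (d.code ++ a) b c (true :: n)) S'
        (T + 5 * d.size) := by
  induction d with
  | nil =>
    intro a b n T h
    exact (runs_loop_N (runs_pop_A (runs_push_C false)) h).mono (by simp; lia)
  | cons l r ihl ihr =>
    intro a c n T h
    have h' := ihl (a := r.code ++ a) (c := true :: c) (n := true :: n) (ihr (T := T) (by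
      simpa [Tree₂.code] using h))
    have h'' := runs_loop_N (s := true) (n := n) (f := fun _ => moveStep pushC)
      (runs_pop_A (s := true) ((runs_push_C true).seq
        ((runs_push_N true).seq (runs_push_N true)))) h'
    simp only [Tree₂.code, List.cons_append, List.append_assoc]
    exact h''.mono (by simp; lia)

theorem runs_moveTree_B (d : Tree₂) :
    Runs (moveTree pushB) (conf i (d.code ++ a) b c []) (conf i a (d.code.reverse ++ b) c [])
      (5 * d.size + 2) :=
  ((runs_push_N true).seq (runs_loop_moveStep_B d (runs_loop_nil rfl))).mono (by lia)

theorem runs_moveTree_C (d : Tree₂) :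
    Runs (moveTree pushC) (conf i (d.code ++ a) b c []) (conf i a b (d.code.reverse ++ c) [])
      (5 * d.size + 2) :=
  ((runs_push_N true).seq (runs_loop_moveStep_C d (runs_loop_nil rfl))).mono (by lia)

theorem runs_loop_B_push_A : ∀ {b a : List Bool},
    Runs (.loop B pushA) (conf i a b c n) (conf i (b.reverse ++ a) [] c n) (2 * b.length + 1)
  | [], _ => runs_loop_nil rfl
  | s :: b, a => by
    have h := runs_loop_B (f := pushA) (runs_push_A s) (runs_loop_B_push_A (b := b) (a := s :: a))
    simp only [List.reverse_cons, List.append_assoc, List.singleton_append, List.length_cons]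
    exact h.mono (by lia)

theorem runs_loop_C_push_A : ∀ {c a : List Bool},
    Runs (.loop C pushA) (conf i a b c n) (conf i (c.reverse ++ a) b [] n) (2 * c.length + 1)
  | [], _ => runs_loop_nil rfl
  | s :: c, a => by
    have h := runs_loop_C (f := pushA) (runs_push_A s) (runs_loop_C_push_A (c := c) (a := s :: a))
    simp only [List.reverse_cons, List.append_assoc, List.singleton_append, List.length_cons]
    exact h.mono (by lia)

theorem runs_loop_C_push_B : ∀ {c b : List Bool},
    Runs (.loop C pushB) (conf i a b c n) (conf i a (c.reverse ++ b) [] n) (2 * c.length + 1)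
  | [], _ => runs_loop_nil rfl
  | s :: c, b => by
    have h := runs_loop_C (f := pushB) (runs_push_B s) (runs_loop_C_push_B (c := c) (b := s :: b))
    simp only [List.reverse_cons, List.append_assoc, List.singleton_append, List.length_cons]
    exact h.mono (by lia)

theorem runs_loop_B_push_A_C : ∀ {b a c : List Bool},
    Runs (.loop B fun s => .seq (.push A s) (.push C s)) (conf i a b c n)
      (conf i (b.reverse ++ a) [] (b.reverse ++ c) n) (3 * b.length + 1)
  | [], _, _ => runs_loop_nil rfl
  | s :: b, a, c => by
    have h := runs_loop_B (f := fun s => .seq (.push A s) (.push C s))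
      ((runs_push_A s).seq (runs_push_C s))
      (runs_loop_B_push_A_C (b := b) (a := s :: a) (c := s :: c))
    simp only [List.reverse_cons, List.append_assoc, List.singleton_append, List.length_cons]
    exact h.mono (by lia)

theorem runs_loop_B_skip : ∀ {b : List Bool},
    Runs (.loop B fun _ => .skip) (conf i a b c n) (conf i a [] c n) (2 * b.length + 1)
  | [] => runs_loop_nil rfl
  | s :: b => (runs_loop_B (f := fun _ => .skip) (s := s) runs_skip runs_loop_B_skip).mono
      (by simp only [List.length_cons]; lia)

/-! ### Rearranging trees on the main stack -/

/-- The stacks with contents `a` on the main stack and nothing else. -/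
def onA (a : List Bool) : ∀ k, List (Alph k) := conf [] a [] [] []

/-- Exchange the two topmost trees. -/
def swap : Cmd Alph :=
  .seq (moveTree pushB) (.seq (moveTree pushC) (.seq (.loop B pushA)
    (.loop C pushA)))

theorem runs_swap (d e : Tree₂) : Runs swap (onA (d.code ++ (e.code ++ a)))
    (onA (e.code ++ (d.code ++ a))) (7 * (d.size + e.size) + 6) := by
  have h := (runs_moveTree_B (i := []) (b := []) (c := []) (a := e.code ++ a) d).seq
    ((runs_moveTree_C e).seq (runs_loop_B_push_A.seq runs_loop_C_push_A))
  simp only [List.append_nil, List.reverse_reverse, List.length_reverse, Tree₂.length_code] at h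
  exact h.mono (by lia)

/-- Duplicate the topmost tree. -/
def dup : Cmd Alph :=
  .seq (moveTree pushB) (.seq (.loop B fun s => .seq (.push A s) (.push C s))
    (.seq (.loop C pushB) (.loop B pushA)))

theorem runs_dup (d : Tree₂) : Runs dup (onA (d.code ++ a))
    (onA (d.code ++ (d.code ++ a))) (12 * d.size + 5) := by
  have h := (runs_moveTree_B (i := []) (b := []) (c := []) (a := a) d).seq
    (runs_loop_B_push_A_C.seq (runs_loop_C_push_B.seq runs_loop_B_push_A))
  simp only [List.append_nil, List.reverse_reverse, List.length_reverse, Tree₂.length_code] at h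
  exact h.mono (by lia)

/-- Remove the topmost tree. -/
def drop : Cmd Alph := .seq (moveTree pushB) (.loop B fun _ => .skip)

theorem runs_drop (d : Tree₂) : Runs drop (onA (d.code ++ a)) (onA a) (7 * d.size + 3) := by
  have h := (runs_moveTree_B (i := []) (b := []) (c := []) (a := a) d).seq runs_loop_B_skip
  simp only [List.append_nil, List.length_reverse, Tree₂.length_code] at h
  exact h.mono (by lia)

/-- Push a string on the main stack. -/
def pushList : List Bool → Cmd Alph
  | [] => .skip
  | s :: l => .seq (pushList l) (.push A s)

theorem runs_pushList : ∀ l : List Bool,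
    Runs (pushList l) (conf i a b c n) (conf i (l ++ a) b c n) (l.length + 1)
  | [] => runs_skip
  | s :: l => (runs_pushList l).seq (runs_push_A s)

/-! ### Polynomially bounded computations on trees -/

open Polynomial

theorem eval_mono (p : ℕ[X]) {m n : ℕ} (h : m ≤ n) : p.eval m ≤ p.eval n := by
  rw [eval_eq_sum, eval_eq_sum]
  exact Finset.sum_le_sum fun k _ => Nat.mul_le_mul_left _ (Nat.pow_le_pow_left h k)

/-- The program `c` replaces the tree `d` on top of the main stack by `d'`, in a time bounded by the
polynomial `p` in the size of `d`. -/
def Computes (c : Cmd Alph) (p : ℕ[X]) (d d' : Tree₂) : Prop :=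
  ∀ a, Runs c (onA (d.code ++ a)) (onA (d'.code ++ a)) (p.eval d.size)

/-- A step pushes at most one symbol, so a time bound is also a bound on the growth of the output.
This is what makes time bounds compose. -/
theorem length_le_of_exec {c : Cmd Alph} {t : ℕ} (h : Exec c S S' t) (k : Stk) :
    (S' k).length ≤ (S k).length + t := by
  induction h with
  | skip S => lia
  | push k' s S =>
    by_cases hk : k = k'
    · subst hk; simp
    · simp [hk]
  | @pop k' c S S' t h ih =>
    refine ih.trans ?_
    by_cases hk : k = k'
    · subst hk; simp; lia
    · simp [hk]
  | seq h₁ h₂ ih₁ ih₂ => lia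
  | loop_nil h => lia
  | @loop_cons k' c S S' S'' a l t₁ t₂ h h₁ h₂ ih₁ ih₂ =>
    have : (update S k' l k).length ≤ (S k).length := by
      by_cases hk : k = k'
      · subst hk; simp [h]
      · simp [hk]
    lia

theorem Computes.size_le {c : Cmd Alph} {p : ℕ[X]} {d d' : Tree₂} (h : Computes c p d d') :
    d'.size ≤ d.size + p.eval d.size := by
  obtain ⟨t, ht, h⟩ := h []
  have := length_le_of_exec h A
  simp only [onA, conf, List.append_nil, Tree₂.length_code] at this
  lia

theorem Computes.seq {c₁ c₂ : Cmd Alph} {p q : ℕ[X]} {d d' d'' : Tree₂} (h₁ : Computes c₁ p d d')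
    (h₂ : Computes c₂ q d' d'') : Computes (.seq c₁ c₂) (p + q.comp (X + p)) d d'' := by
  intro a
  refine ((h₁ a).seq (h₂ a)).mono ?_
  have := eval_mono q h₁.size_le
  simp only [eval_add, eval_comp, eval_X]
  lia

/-- Compute the pair of the results of two programs. -/
def pairCmd (c₁ c₂ : Cmd Alph) : Cmd Alph :=
  .seq dup (.seq c₂ (.seq swap (.seq c₁ (.push A true))))

/-- Duplicating costs `12 * X + 5`; the second result has size at most `X + q`, so the exchange
costs at most `7 * (2 * X + q) + 6`; the final push adds one. -/
theorem Computes.pair {c₁ c₂ : Cmd Alph} {p q : ℕ[X]} {d d₁ d₂ : Tree₂} (h₁ : Computes c₁ p d d₁)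
    (h₂ : Computes c₂ q d d₂) :
    Computes (pairCmd c₁ c₂) (26 * X + 12 + 8 * q + p) d (.cons d₁ d₂) := by
  intro a
  have h := (runs_dup (a := a) d).seq ((h₂ (d.code ++ a)).seq ((runs_swap (a := a) d₂ d).seq
    ((h₁ (d₂.code ++ a)).seq (runs_push_A true))))
  simp only [Tree₂.code, List.cons_append, List.append_assoc]
  refine h.mono ?_
  have := h₂.size_le
  simp only [eval_add, eval_mul, eval_ofNat, eval_X]
  lia

/-- Replace a tree by its left subtree. -/
def hdCmd : Cmd Alph :=
  .pop A fun
    | none => .skip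
    | some true => .seq swap drop
    | some false => .push A false

theorem computes_hd (d e : Tree₂) : Computes hdCmd (14 * X + 10) (.cons d e) d := by
  intro a
  simp only [Tree₂.code, List.cons_append, List.append_assoc]
  refine (runs_pop_A ((runs_swap d e).seq (runs_drop e))).mono ?_
  simp only [eval_add, eval_mul, eval_ofNat, eval_X, Tree₂.size_cons]
  lia

theorem computes_hd_nil : Computes hdCmd (14 * X + 10) .nil .nil := by
  intro a
  refine (runs_pop_A (runs_push_A false)).mono ?_
  simp only [eval_add, eval_mul, eval_ofNat, eval_X]
  lia

/-- Replace a tree by its right subtree. -/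
def tlCmd : Cmd Alph :=
  .pop A fun
    | none => .skip
    | some true => drop
    | some false => .push A false

theorem computes_tl (d e : Tree₂) : Computes tlCmd (7 * X + 4) (.cons d e) e := by
  intro a
  simp only [Tree₂.code, List.cons_append, List.append_assoc]
  refine (runs_pop_A (runs_drop d)).mono ?_
  simp only [eval_add, eval_mul, eval_ofNat, eval_X, Tree₂.size_cons]
  lia

theorem computes_tl_nil : Computes tlCmd (7 * X + 4) .nil .nil := by
  intro a
  refine (runs_pop_A (runs_push_A false)).mono ?_
  simp only [eval_add, eval_mul, eval_ofNat, eval_X]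
  lia

theorem computes_const (d e : Tree₂) :
    Computes (.seq drop (pushList e.code)) (7 * X + Polynomial.C (e.size + 4)) d e := by
  intro a
  refine ((runs_drop d).seq (runs_pushList e.code)).mono ?_
  simp only [eval_add, eval_mul, eval_ofNat, eval_X, eval_C, Tree₂.length_code]
  lia

/-- Branch on whether the result of `c` is a leaf. -/
def iteCmd (c c₁ c₂ : Cmd Alph) : Cmd Alph :=
  .seq dup (.seq c (.pop A fun
    | none => .skip
    | some true => .seq drop (.seq drop c₁)
    | some false => c₂))

/-- The bound of the branch not taken is added so that both outcomes of the test share one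
polynomial. -/
theorem Computes.ite_cons {c c₁ c₂ : Cmd Alph} {p p₁ : ℕ[X]} {d d' e e' : Tree₂}
    (h : Computes c p d (.cons e e')) (h₁ : Computes c₁ p₁ d d') (p₂ : ℕ[X]) :
    Computes (iteCmd c c₁ c₂) (19 * X + 20 + 8 * p + p₁ + p₂) d d' := by
  intro a
  have h' := h (d.code ++ a)
  simp only [Tree₂.code, List.cons_append, List.append_assoc] at h'
  refine ((runs_dup d).seq (h'.seq (runs_pop_A ((runs_drop e).seq ((runs_drop e').seq
    (h₁ a)))))).mono ?_
  have := h.size_le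
  simp only [eval_add, eval_mul, eval_ofNat, eval_X, Tree₂.size_cons] at this ⊢
  lia

theorem Computes.ite_nil {c c₁ c₂ : Cmd Alph} {p p₂ : ℕ[X]} {d d' : Tree₂}
    (h : Computes c p d .nil) (p₁ : ℕ[X]) (h₂ : Computes c₂ p₂ d d') :
    Computes (iteCmd c c₁ c₂) (19 * X + 20 + 8 * p + p₁ + p₂) d d' := by
  intro a
  refine ((runs_dup d).seq ((h (d.code ++ a)).seq (runs_pop_A (h₂ a)))).mono ?_
  simp only [eval_add, eval_mul, eval_ofNat, eval_X]
  lia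

/-- Put a flag on `N` if the left subtree of the topmost tree is not a leaf. -/
def flagCmd : Cmd Alph :=
  .pop A fun
    | some true => .pop A fun
      | some true => .seq (.push A true) (.seq (.push A true) (.push N true))
      | some false => .seq (.push A false) (.push A true)
      | none => .skip
    | _ => .skip

theorem runs_flag_cons (d e f : Tree₂) : Runs flagCmd (onA ((Tree₂.cons (.cons d e) f).code ++ a))
    (conf [] ((Tree₂.cons (.cons d e) f).code ++ a) [] [] [true]) 5 :=
  (runs_pop_A (runs_pop_A ((runs_push_A true).seq ((runs_push_A true).seq (runs_push_N true)))))

theorem runs_flag_nil (f : Tree₂) : Runs flagCmd (onA ((Tree₂.cons .nil f).code ++ a))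
    (onA ((Tree₂.cons .nil f).code ++ a)) 5 :=
  (runs_pop_A (runs_pop_A ((runs_push_A false).seq (runs_push_A true)))).mono (by lia)

/-- Repeat `c` as long as the left subtree of the topmost tree is not a leaf. -/
def whileCmd (c : Cmd Alph) : Cmd Alph :=
  -- The loop pops the flag before its body runs, so `c` finds `N` empty and may use it for moving
  -- trees.
  .seq flagCmd (.loop N fun _ => .seq c flagCmd)

end Stk

/-! ### Functions computable in polynomial time -/

/-- Types whose elements are represented by binary trees. -/
class TreeRep (α : Type) where
  /-- the tree representing an element -/
  rep : α → Tree₂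

instance : TreeRep Bool where
  rep b := cond b (.cons .nil .nil) .nil

instance {α β : Type} [TreeRep α] [TreeRep β] : TreeRep (α × β) where
  rep x := .cons (TreeRep.rep x.1) (TreeRep.rep x.2)

instance {α : Type} [TreeRep α] : TreeRep (List α) where
  rep l := l.foldr (fun a d => .cons (TreeRep.rep a) d) .nil

section PolyFun

variable {α β γ σ : Type} [TreeRep α] [TreeRep β] [TreeRep γ] [TreeRep σ]

/-- The size of the tree representing an element. -/
def repSize (a : α) : ℕ := (TreeRep.rep a).size

@[simp] theorem repSize_prod (x : α × β) : repSize x = repSize x.1 + repSize x.2 + 1 :=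
  Tree₂.size_cons _ _

@[simp] theorem repSize_nil : repSize ([] : List α) = 1 := rfl

@[simp] theorem repSize_cons (a : α) (l : List α) :
    repSize (a :: l) = repSize a + repSize l + 1 := Tree₂.size_cons _ _

theorem repSize_bool_le (b : Bool) : repSize b ≤ 3 := by
  cases b <;> decide

theorem length_lt_repSize (l : List α) : l.length < repSize l := by
  induction l with
  | nil => simp
  | cons a l ih => simp; lia

theorem repSize_le_of_mem {l : List α} {a : α} (h : a ∈ l) : repSize a ≤ repSize l := by
  induction l with
  | nil => simp at h
  | cons b l ih =>
    rcases List.mem_cons.1 h with rfl | h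
    · simp; lia
    · simp; have := ih h; lia

open Stk Polynomial

/-- The function `f` is computable in polynomial time on the representing trees. -/
@[fun_prop]
def PolyFun (f : α → β) : Prop :=
  ∃ (c : Cmd Alph) (p : ℕ[X]), ∀ a, Computes c p (TreeRep.rep a) (TreeRep.rep (f a))

namespace PolyFun

theorem repSize_le {f : α → β} (hf : PolyFun f) :
    ∃ p : ℕ[X], ∀ a, repSize (f a) ≤ p.eval (repSize a) := by
  obtain ⟨c, p, h⟩ := hf
  refine ⟨X + p, fun a => ?_⟩
  simpa [repSize] using (h a).size_le

theorem of_rep_eq {f : α → β} (h : ∀ a, TreeRep.rep (f a) = TreeRep.rep a) : PolyFun f :=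
  ⟨.skip, 1, fun a r => by rw [h]; exact runs_skip.mono (by simp)⟩

@[fun_prop]
theorem id : PolyFun (fun a : α => a) := of_rep_eq fun _ => rfl

@[fun_prop]
theorem const (b : β) : PolyFun (fun _ : α => b) := ⟨_, _, fun _ => computes_const _ _⟩

@[fun_prop]
theorem comp {g : β → γ} {f : α → β} (hg : PolyFun g) (hf : PolyFun f) :
    PolyFun (fun a => g (f a)) := by
  obtain ⟨c, p, hc⟩ := hg
  obtain ⟨c', p', hc'⟩ := hf
  exact ⟨_, _, fun a => (hc' a).seq (hc (f a))⟩

@[fun_prop]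
theorem pair {f : α → β} {g : α → γ} (hf : PolyFun f) (hg : PolyFun g) :
    PolyFun (fun a => (f a, g a)) := by
  obtain ⟨c, p, hc⟩ := hf
  obtain ⟨c', p', hc'⟩ := hg
  exact ⟨_, _, fun a => (hc a).pair (hc' a)⟩

@[fun_prop]
theorem fst {f : α → β × γ} (hf : PolyFun f) : PolyFun (fun a => (f a).1) :=
  comp (g := Prod.fst) ⟨_, _, fun x => computes_hd (TreeRep.rep x.1) (TreeRep.rep x.2)⟩ hf

@[fun_prop]
theorem snd {f : α → β × γ} (hf : PolyFun f) : PolyFun (fun a => (f a).2) :=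
  comp (g := Prod.snd) ⟨_, _, fun x => computes_tl (TreeRep.rep x.1) (TreeRep.rep x.2)⟩ hf

@[fun_prop]
theorem cons {f : α → β} {g : α → List β} (hf : PolyFun f) (hg : PolyFun g) :
    PolyFun (fun a => f a :: g a) :=
  comp (g := fun x : β × List β => x.1 :: x.2) (of_rep_eq fun _ => rfl) (hf.pair hg)

@[fun_prop]
theorem tail {f : α → List β} (hf : PolyFun f) : PolyFun (fun a => (f a).tail) := by
  refine comp (g := List.tail) ⟨tlCmd, 7 * X + 4, fun l => ?_⟩ hf
  cases l with
  | nil => exact computes_tl_nil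
  | cons a l => exact computes_tl _ _

-- For an empty list, `hdCmd` leaves a leaf. The element type must therefore have a default value
-- represented by a leaf, as lists and truth values do.
@[fun_prop]
theorem head_list {f : α → List (List β)} (hf : PolyFun f) : PolyFun (fun a => (f a).headI) := by
  refine comp (g := List.headI) ⟨hdCmd, 14 * X + 10, fun l => ?_⟩ hf
  cases l with
  | nil => exact computes_hd_nil
  | cons a l => exact computes_hd _ _

@[fun_prop]
theorem head_bool {f : α → List Bool} (hf : PolyFun f) : PolyFun (fun a => (f a).headI) := by
  refine comp (g := List.headI) ⟨hdCmd, 14 * X + 10, fun l => ?_⟩ hf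
  cases l with
  | nil => exact computes_hd_nil
  | cons a l => exact computes_hd _ _

@[fun_prop]
theorem cond {b : α → Bool} {f g : α → β} (hb : PolyFun b) (hf : PolyFun f) (hg : PolyFun g) :
    PolyFun (fun a => bif b a then f a else g a) := by
  obtain ⟨c, p, hc⟩ := hb
  obtain ⟨c₁, p₁, hc₁⟩ := hf
  obtain ⟨c₂, p₂, hc₂⟩ := hg
  refine ⟨iteCmd c c₁ c₂, 19 * X + 20 + 8 * p + p₁ + p₂, fun a => ?_⟩
  have h := hc a
  cases hba : b a with
  | true =>
    beta_reduce
    rw [hba] at h ⊢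
    exact h.ite_cons (hc₁ a) p₂
  | false =>
    beta_reduce
    rw [hba] at h ⊢
    exact h.ite_nil p₁ (hc₂ a)

@[fun_prop]
theorem isEmpty {f : α → List β} (hf : PolyFun f) : PolyFun (fun a => (f a).isEmpty) := by
  obtain ⟨c, p, hc⟩ := hf
  obtain ⟨c₁, p₁, hc₁⟩ := const (α := α) false
  obtain ⟨c₂, p₂, hc₂⟩ := const (α := α) true
  refine ⟨iteCmd c c₁ c₂, 19 * X + 20 + 8 * p + p₁ + p₂, fun a => ?_⟩
  have h := hc a
  cases hfa : f a with
  | cons b l =>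
    beta_reduce
    rw [hfa] at h ⊢
    exact h.ite_cons (hc₁ a) p₂
  | nil =>
    beta_reduce
    rw [hfa] at h ⊢
    exact h.ite_nil p₁ (hc₂ a)

/-- One round of a fold, on the tree of `(a :: l, (x, s))`. -/
def foldStep (c : Cmd Alph) : Cmd Alph :=
  pairCmd (.seq hdCmd tlCmd) (pairCmd (.seq tlCmd hdCmd)
    (.seq (pairCmd (.seq tlCmd hdCmd) (pairCmd (.seq tlCmd tlCmd) (.seq hdCmd hdCmd))) c))

theorem computes_foldStep (c : Cmd Alph) (p : ℕ[X]) : ∃ q : ℕ[X], ∀ a l x s s' : Tree₂,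
    Computes c p (.cons x (.cons s a)) s' →
      Computes (foldStep c) q (.cons (.cons a l) (.cons x s)) (.cons l (.cons x s')) :=
  ⟨_, fun _ _ _ _ _ h => .pair (.seq (computes_hd _ _) (computes_tl _ _))
    (.pair (.seq (computes_tl _ _) (computes_hd _ _))
      (.seq (.pair (.seq (computes_tl _ _) (computes_hd _ _))
        (.pair (.seq (computes_tl _ _) (computes_tl _ _))
          (.seq (computes_hd _ _) (computes_hd _ _)))) h))⟩

theorem runs_flag_list (l : List α) (d : Tree₂) (r : List Bool) :
    Runs flagCmd (onA ((Tree₂.cons (TreeRep.rep l) d).code ++ r))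
      (conf [] ((Tree₂.cons (TreeRep.rep l) d).code ++ r) [] []
        (bif l.isEmpty then [] else [true])) 5 := by
  cases l with
  | nil => exact runs_flag_nil d
  | cons a l => exact runs_flag_cons _ _ d

/-- Current size plus `R` times the number of remaining rounds never increases, so every round
starts with size at most `M` and costs at most `q.eval M + 6`. -/
theorem runs_fold {c : Cmd Alph} {q : ℕ[X]} {step : σ → α → σ} {x : β} {R M : ℕ}
    (hc : ∀ a (l : List α) s, Computes (foldStep c) q (TreeRep.rep (a :: l, (x, s)))
      (TreeRep.rep (l, (x, step s a)))) (r : List Bool) :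
    ∀ (l : List α) (s : σ), (∀ a ∈ l, ∀ s, repSize (step s a) ≤ repSize s + R) →
      repSize (l, (x, s)) + l.length * R ≤ M →
      Runs (.loop N fun _ => .seq (foldStep c) flagCmd)
        (conf [] ((TreeRep.rep (l, (x, s))).code ++ r) [] [] (bif l.isEmpty then [] else [true]))
        (onA ((TreeRep.rep (([] : List α), (x, l.foldl step s))).code ++ r))
        (l.length * (q.eval M + 6) + 1) := by
  intro l
  induction l with
  | nil => exact fun s _ _ => (runs_loop_nil rfl).mono (by simp)
  | cons a l ih =>
    intro s hR hM
    have hs := hR a (by simp) s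
    have h := ih (step s a) (fun a ha => hR a (by simp [ha])) (by
      simp only [repSize_prod, repSize_cons, List.length_cons, add_mul] at hM ⊢
      lia)
    refine (runs_loop_N (f := fun _ => .seq (foldStep c) flagCmd)
      ((hc a l s r).seq (runs_flag_list l _ r)) h).mono ?_
    have := eval_mono q (show repSize (a :: l, (x, s)) ≤ M by lia)
    simp only [List.length_cons, add_mul]
    change q.eval (repSize (a :: l, (x, s))) + 5 + _ + 1 ≤ _
    lia

/-- The growth allowed per round depends on the fixed input `x` but not on the state `s`. All
intermediate states thus have polynomial size, whereas an arbitrary polynomial-time step could make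
the state explode when iterated. -/
theorem foldl {l : α → List β} {start : α → σ} {step : α → σ → β → σ} (hl : PolyFun l)
    (hi : PolyFun start) (hs : PolyFun fun z : α × σ × β => step z.1 z.2.1 z.2.2)
    (hr : ∃ r : ℕ[X], ∀ x, ∀ b ∈ l x, ∀ s,
      repSize (step x s b) ≤ repSize s + r.eval (repSize x)) :
    PolyFun fun x => (l x).foldl (step x) (start x) := by
  have hpre : PolyFun fun x => (l x, (x, start x)) := hl.pair (id.pair hi)
  obtain ⟨c₀, p₀, h₀⟩ := hpre
  obtain ⟨c, p, hc⟩ := hs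
  obtain ⟨r, hr⟩ := hr
  obtain ⟨q, hq⟩ := computes_foldStep c p
  have hw : ∀ x, Computes (whileCmd (foldStep c)) (X * (q.comp (X + X * r) + 6) + 6)
      (TreeRep.rep (l x, (x, start x)))
      (TreeRep.rep (([] : List β), (x, (l x).foldl (step x) (start x)))) := by
    intro x a
    have hx : repSize x ≤ repSize (l x, (x, start x)) := by simp; lia
    have hlen : (l x).length ≤ repSize (l x, (x, start x)) := by
      have := length_lt_repSize (l x)
      simp only [repSize_prod]
      lia
    have h := runs_fold (step := step x) (x := x) (R := r.eval (repSize x))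
      (M := (X + X * r).eval (repSize (l x, (x, start x))))
      (fun a l s => hq _ _ _ _ _ (hc (x, (s, a)))) a (l x) (start x)
      (hr x) (by
        simp only [eval_add, eval_X, eval_mul]
        exact Nat.add_le_add_left (Nat.mul_le_mul hlen (eval_mono r hx)) _)
    refine ((runs_flag_list (l x) _ a).seq h).mono ?_
    have := Nat.mul_le_mul_right (q.eval ((X + X * r).eval (repSize (l x, (x, start x)))) + 6) hlen
    simp only [eval_add, eval_mul, eval_ofNat, eval_comp, eval_X] at this ⊢
    change 5 + _ ≤ repSize (l x, (x, start x)) * (q.eval (repSize (l x, (x, start x)) +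
      repSize (l x, (x, start x)) * r.eval (repSize (l x, (x, start x)))) + 6) + 6
    lia
  exact ⟨_, _, fun x => (h₀ x).seq ((hw x).seq ((computes_tl _ _).seq (computes_tl _ _)))⟩

end PolyFun

/-! ### Machines for polynomial time functions -/

section Machine

open Computability Turing

/-- The code of an input symbol as a pair of truth values, identifying the two brackets. -/
def symbolCode : Γ' → Bool × Bool
  | .bit b => (true, b)
  | .comma => (false, true)
  | _ => (false, false)

/-- Read the input and write the reversed list of the codes of its symbols on the main stack. -/
def readCmd : Cmd Alph :=
  .seq (.push A false) (.loop inp fun s : Γ' =>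
    .seq (pushList (TreeRep.rep (symbolCode s)).code) (.push A true))

theorem size_rep_symbolCode_le (s : Γ') : (TreeRep.rep (symbolCode s)).size ≤ 7 := by
  cases s with
  | bit b => cases b <;> decide
  | _ => decide

theorem runs_loop_readCmd : ∀ (w : List Γ') (l : List (Bool × Bool)),
    Runs (.loop inp fun s : Γ' => .seq (pushList (TreeRep.rep (symbolCode s)).code) (.push A true))
      (conf w (TreeRep.rep l).code [] [] [])
      (onA (TreeRep.rep ((w.map symbolCode).reverse ++ l)).code) (10 * w.length + 1)
  | [], l => runs_loop_nil rfl
  | s :: w, l => by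
    have h := runs_loop_inp (i := w) (s := s) ((runs_pushList (TreeRep.rep (symbolCode s)).code).seq
      (runs_push_A true)) (runs_loop_readCmd w (symbolCode s :: l))
    simp only [List.map_cons, List.reverse_cons, List.append_assoc, List.singleton_append]
    refine h.mono ?_
    have := size_rep_symbolCode_le s
    simp only [Tree₂.length_code, List.length_cons]
    lia

/-- Replace the tree of a truth value by the truth value. -/
def answerCmd : Cmd Alph :=
  .pop A fun
    | some true => .seq drop (.seq drop (.push A true))
    | _ => .push A false

theorem runs_answerCmd (b : Bool) : Runs answerCmd (onA (TreeRep.rep b).code) (onA [b]) 22 := by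
  cases b with
  | false => exact (runs_pop_A (runs_push_A false)).mono (by lia)
  | true =>
    have h : Runs (.seq drop (.seq drop (.push A true)))
        (onA (Tree₂.nil.code ++ (Tree₂.nil.code ++ []))) (onA [true]) 21 :=
      (runs_drop .nil).seq ((runs_drop .nil).seq (runs_push_A true))
    exact runs_pop_A (s := true) h

theorem repSize_map_symbolCode_le (w : List Γ') :
    repSize (w.map symbolCode) ≤ 8 * w.length + 1 := by
  induction w with
  | nil => simp
  | cons s w ih =>
    have : repSize (symbolCode s) ≤ 7 := size_rep_symbolCode_le s
    simp only [List.map_cons, repSize_cons, List.length_cons]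
    lia

/-- Popping the input while pushing the codes reverses it, so `g` receives the reversed string.
Reading costs at most ten steps per symbol and produces a tree of size at most `8 * w.length + 1`;
decoding the answer and halting take constant time. -/
theorem PolyFun.tm2ComputableInPolyTime {δ : Type} (enc : δ → List Γ')
    {g : List (Bool × Bool) → Bool} (hg : PolyFun g) :
    Nonempty (TM2ComputableInPolyTime enc encodeBool
      fun a => g ((enc a).reverse.map symbolCode)) := by
  obtain ⟨c, p, hc⟩ := hg
  have hrun : ∀ w : List Γ', ∃ t, t + 1 ≤ (10 * X + 26 + p.comp (8 * X + 1)).eval w.length ∧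
      Cmd.Exec (.seq readCmd (.seq c answerCmd)) (Function.update (fun _ => []) inp w)
        (Function.update (fun _ => []) A [g (w.reverse.map symbolCode)]) t := by
    intro w
    have h₁ : Runs readCmd (conf w [] [] [] []) _ _ :=
      (runs_push_A false).seq (runs_loop_readCmd w [])
    have h₂ := hc (w.reverse.map symbolCode) []
    simp only [List.append_nil, ← List.map_reverse] at h₁ h₂
    obtain ⟨t, ht, h⟩ := h₁.seq (h₂.seq (runs_answerCmd _))
    have h₀ : ∀ k, (fun _ => [] : ∀ k, List (Alph k)) k = conf [] [] [] [] [] k := by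
      intro k; cases k <;> rfl
    refine ⟨t, ?_, ?_⟩
    · have hs : (TreeRep.rep (w.reverse.map symbolCode)).size ≤ 8 * w.length + 1 := by
        simpa [repSize] using repSize_map_symbolCode_le w.reverse
      have := eval_mono p hs
      simp only [eval_add, eval_mul, eval_ofNat, eval_X, eval_comp, eval_one]
      lia
    · rw [funext h₀, update_inp, update_A]
      exact h
  exact ⟨{
    tm := Cmd.machine inp A (.seq readCmd (.seq c answerCmd))
    inputAlphabet := Equiv.refl Γ'
    outputAlphabet := Equiv.refl Bool
    time := 10 * X + 26 + p.comp (8 * X + 1)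
    outputsFun := fun a => Classical.choice (by
      obtain ⟨t, ht, h⟩ := hrun (enc a)
      have h' := Cmd.outputs_of_exec h ht
      rw [show (Equiv.refl Γ').invFun = _root_.id from rfl,
        show (Equiv.refl Bool).invFun = _root_.id from rfl]
      erw [List.map_id, List.map_id]
      exact h') }⟩

end Machine

/-! ### Polynomial time functions on lists -/

namespace PolyFun

@[fun_prop]
theorem not {f : α → Bool} (hf : PolyFun f) : PolyFun fun a => !(f a) := by
  have : PolyFun fun a => bif f a then false else true := by fun_prop
  convert this using 2 with a
  cases f a <;> rfl

@[fun_prop]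
theorem and {f g : α → Bool} (hf : PolyFun f) (hg : PolyFun g) :
    PolyFun fun a => f a && g a := by
  have : PolyFun fun a => bif f a then g a else false := by fun_prop
  convert this using 2 with a
  cases f a <;> rfl

@[fun_prop]
theorem or {f g : α → Bool} (hf : PolyFun f) (hg : PolyFun g) :
    PolyFun fun a => f a || g a := by
  have : PolyFun fun a => bif f a then true else g a := by fun_prop
  convert this using 2 with a
  cases f a <;> rfl

@[fun_prop]
theorem reverse {l : α → List β} (hl : PolyFun l) : PolyFun fun x => (l x).reverse := by
  obtain ⟨q, hq⟩ := hl.repSize_le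
  have h := foldl (start := fun _ => []) (step := fun _ s b => b :: s) hl (by fun_prop)
    (by fun_prop) ⟨q + 1, fun x b hb s => by
      have := (repSize_le_of_mem hb).trans (hq x)
      simp only [repSize_cons, eval_add, eval_one]
      lia⟩
  convert h using 2 with x
  simp

theorem foldr {l : α → List β} {start : α → σ} {step : α → β → σ → σ} (hl : PolyFun l)
    (hi : PolyFun start) (hs : PolyFun fun z : α × β × σ => step z.1 z.2.1 z.2.2)
    (hr : ∃ r : ℕ[X], ∀ x, ∀ b ∈ l x, ∀ s,
      repSize (step x b s) ≤ repSize s + r.eval (repSize x)) :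
    PolyFun fun x => (l x).foldr (step x) (start x) := by
  obtain ⟨r, hr⟩ := hr
  have h := foldl (step := fun x s b => step x b s) hl.reverse hi
    (hs.comp (f := fun z : α × σ × β => (z.1, z.2.2, z.2.1)) (by fun_prop))
    ⟨r, fun x b hb s => hr x b (List.mem_reverse.1 hb) s⟩
  convert h using 2 with x
  simp

@[fun_prop]
theorem any {l : α → List β} {p : α → β → Bool} (hl : PolyFun l)
    (hp : PolyFun fun z : α × β => p z.1 z.2) : PolyFun fun x => (l x).any (p x) := by
  have h := foldr (start := fun _ => false) (step := fun x b s => p x b || s) hl (by fun_prop)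
    (by fun_prop) ⟨3, fun x b _ s => by
      have := repSize_bool_le (p x b || s)
      simp only [eval_ofNat]
      lia⟩
  convert h using 2 with x
  induction l x with
  | nil => rfl
  | cons b l ih => simp [ih]

@[fun_prop]
theorem all {l : α → List β} {p : α → β → Bool} (hl : PolyFun l)
    (hp : PolyFun fun z : α × β => p z.1 z.2) : PolyFun fun x => (l x).all (p x) := by
  have h : PolyFun fun x => !((l x).any fun b => !(p x b)) := by fun_prop
  convert h using 2 with x
  simp [List.all_eq_not_any_not]

theorem repSize_le_eval_of_mem {l : α → List β} {f : α → β → γ} (hl : PolyFun l)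
    (hf : PolyFun fun z : α × β => f z.1 z.2) :
    ∃ r : ℕ[X], ∀ x, ∀ b ∈ l x, repSize (f x b) ≤ r.eval (repSize x) := by
  obtain ⟨p, hp⟩ := hf.repSize_le
  obtain ⟨q, hq⟩ := hl.repSize_le
  refine ⟨p.comp (X + q + 1), fun x b hb => (hp (x, b)).trans ?_⟩
  have := (repSize_le_of_mem hb).trans (hq x)
  rw [eval_comp]
  apply eval_mono
  simp only [repSize_prod, eval_add, eval_X, eval_one]
  lia

@[fun_prop]
theorem map {l : α → List β} {f : α → β → γ} (hl : PolyFun l)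
    (hf : PolyFun fun z : α × β => f z.1 z.2) : PolyFun fun x => (l x).map (f x) := by
  obtain ⟨r, hr⟩ := repSize_le_eval_of_mem hl hf
  have h := foldr (start := fun _ => []) (step := fun x b s => f x b :: s) hl (by fun_prop)
    (by fun_prop) ⟨r + 1, fun x b hb s => by
      have := hr x b hb
      simp only [repSize_cons, eval_add, eval_one]
      lia⟩
  convert h using 2 with x
  induction l x with
  | nil => rfl
  | cons b l ih => rw [List.map_cons, ih, List.foldr_cons]

@[fun_prop]
theorem filter {l : α → List β} {p : α → β → Bool} (hl : PolyFun l)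
    (hp : PolyFun fun z : α × β => p z.1 z.2) : PolyFun fun x => (l x).filter (p x) := by
  obtain ⟨r, hr⟩ := repSize_le_eval_of_mem (f := fun _ b => b) hl (by fun_prop)
  have h := foldr (start := fun _ => []) (step := fun x b s => bif p x b then b :: s else s) hl
    (by fun_prop) (by fun_prop) ⟨r + 1, fun x b hb s => by
      have := hr x b hb
      cases p x b <;> simp only [cond_true, cond_false, repSize_cons, eval_add, eval_one] <;> lia⟩
  convert h using 2 with x
  induction l x with
  | nil => rfl
  | cons b l ih => cases hb : p x b <;> simp [hb, ih]

theorem repSize_append_le (l m : List α) : repSize (l ++ m) ≤ repSize l + repSize m := by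
  induction l with
  | nil => simp
  | cons a l ih => simp only [List.cons_append, repSize_cons]; lia

@[fun_prop]
theorem append {l m : α → List β} (hl : PolyFun l) (hm : PolyFun m) :
    PolyFun fun x => l x ++ m x := by
  obtain ⟨r, hr⟩ := repSize_le_eval_of_mem (f := fun _ b => b) hl (by fun_prop)
  have h := foldr (step := fun _ b s => b :: s) hl hm (by fun_prop) ⟨r + 1, fun x b hb s => by
    have := hr x b hb
    simp only [repSize_cons, eval_add, eval_one]
    lia⟩
  convert h using 2 with x
  simp

@[fun_prop]
theorem flatMap {l : α → List β} {f : α → β → List γ} (hl : PolyFun l)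
    (hf : PolyFun fun z : α × β => f z.1 z.2) : PolyFun fun x => (l x).flatMap (f x) := by
  obtain ⟨r, hr⟩ := repSize_le_eval_of_mem hl hf
  have h := foldr (start := fun _ => []) (step := fun x b s => f x b ++ s) hl (by fun_prop)
    (by fun_prop) ⟨r, fun x b hb s => by
      have := hr x b hb
      have := repSize_append_le (f x b) s
      lia⟩
  convert h using 2 with x
  induction l x with
  | nil => rfl
  | cons b l ih => simp [ih]

end PolyFun

/-! ### Comparing names and lengths -/

theorem repSize_tail_le (l : List α) : repSize l.tail ≤ repSize l := by
  cases l <;> simp; lia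

theorem repSize_headI_add_tail_le (l : List (List α)) :
    repSize l.headI + repSize l.tail ≤ repSize l + 1 := by
  cases l
  · simp [default]
  · simp; lia

/-- Equality of two bit strings. -/
def nameEq (a b : List Bool) : Bool :=
  let r := a.foldl (fun s x =>
    (s.1 && !s.2.isEmpty && bif x then s.2.headI else !s.2.headI, s.2.tail)) (true, b)
  r.1 && r.2.isEmpty

theorem nameEq_iff {a b : List Bool} : nameEq a b = true ↔ a = b := by
  -- The flag is generalised for the induction: once it is false it stays false.
  have key : ∀ (a b : List Bool) (t : Bool), (let r := a.foldl (fun s x =>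
      (s.1 && !s.2.isEmpty && bif x then s.2.headI else !s.2.headI, s.2.tail)) (t, b)
      r.1 && r.2.isEmpty) = true ↔ t = true ∧ a = b := by
    intro a
    induction a with
    | nil => intro b t; cases b <;> simp
    | cons x a ih =>
      intro b t
      simp only [List.foldl_cons]
      rw [ih]
      cases b with
      | nil => simp
      | cons y b => cases x <;> cases y <;> cases t <;> simp
  exact (key a b true).trans (by simp)

/-- The list `l` is at most as long as `m`. -/
def lengthLE {α β : Type} (l : List α) (m : List β) : Bool :=
  (m.foldl (fun r _ => r.tail) l).isEmpty

theorem lengthLE_iff {α β : Type} {l : List α} {m : List β} :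
    lengthLE l m = true ↔ l.length ≤ m.length := by
  unfold lengthLE
  induction m generalizing l with
  | nil => cases l <;> simp
  | cons b m ih =>
    rw [List.foldl_cons, ih]
    cases l <;> simp

namespace PolyFun

@[fun_prop]
theorem nameEq {f g : α → List Bool} (hf : PolyFun f) (hg : PolyFun g) :
    PolyFun fun x => nameEq (f x) (g x) := by
  have h := foldl (start := fun x => (true, g x)) (step := fun _ s x =>
    (s.1 && !s.2.isEmpty && bif x then s.2.headI else !s.2.headI, s.2.tail)) hf (by fun_prop)
    (by fun_prop) ⟨3, fun x b _ s => by
      have h₁ := repSize_bool_le (s.1 && !s.2.isEmpty && bif b then s.2.headI else !s.2.headI)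
      have h₂ := repSize_tail_le s.2
      rw [repSize_prod, repSize_prod]
      simp only [eval_ofNat]
      lia⟩
  unfold _root_.nameEq
  fun_prop

@[fun_prop]
theorem lengthLE {f : α → List β} {g : α → List γ} (hf : PolyFun f) (hg : PolyFun g) :
    PolyFun fun x => lengthLE (f x) (g x) := by
  have h := foldl (start := f) (step := fun _ s _ => s.tail) hg hf (by fun_prop)
    ⟨0, fun x b _ s => by simpa using repSize_tail_le s⟩
  unfold _root_.lengthLE
  fun_prop

end PolyFun

/-! ### The algorithms -/

namespace President

/-- The name of a candidate or a party. -/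
abbrev Name : Type := List Bool

/-- A candidate with its party. -/
abbrev Cand : Type := Name × Name

/-- `a` stands before `b` on the ballot. -/
def before (ballot : List Name) (a b : Name) : Bool :=
  ballot.foldr (fun x r => bif nameEq x b then false else bif nameEq x a then true else r) false

/-- No two different candidates in the list have the same party. -/
def consistent (S : List Cand) : Bool :=
  S.all fun a => S.all fun b => !nameEq a.2 b.2 || nameEq a.1 b.1

/-- The ballot ranks `x` above all other members of `S`. -/
def beats (S : List Cand) (x : Cand) (ballot : List Name) : Bool :=
  S.all fun d => nameEq d.1 x.1 || before ballot x.1 d.1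

/-- The ballot ranks `x` above all other candidates that can be nominated together with `S`. -/
def supports (cands S : List Cand) (x : Cand) (ballot : List Name) : Bool :=
  cands.all fun d => nameEq d.1 x.1 ||
    (S.any (fun y => nameEq y.2 d.2) && !S.any (fun y => nameEq y.1 d.1)) ||
    before ballot x.1 d.1

/-- The ballots on which `x` is ranked above all candidates that can be nominated with `S`. -/
def supporters (cands : List Cand) (ballots : List (List Name)) (S : List Cand) (x : Cand) :
    List (List Name) :=
  ballots.filter (supports cands S x)

/-- All lists of length `n` of members of `L`. -/
def tuples (L : List Cand) : ℕ → List (List Cand)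
  | 0 => [[]]
  | n + 1 => L.flatMap fun a => (tuples L n).map fun t => a :: t

/-- Decision procedure for the Necessary President problem: look for few nominees that force the
distinguished party to be beaten. -/
def necessary (I : Name × List Cand × List (List Name)) : Bool :=
  -- Five candidates: a rival, two neighbours of the distinguished party and two neighbours of the
  -- rival's party.
  !I.2.1.any fun x => nameEq x.2 I.1 && (tuples I.2.1 5).any fun t =>
    consistent (x :: t) && t.any fun y =>
      !lengthLE (supporters I.2.1 I.2.2 (x :: t) y) (I.2.2.filter (beats (x :: t) x))

/-- The nominees `u` are compatible with `T` and get at most as many votes as there are ballots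
in `B`. -/
def valid (cands : List Cand) (ballots : List (List Name)) (T : List Cand) (B : List (List Name))
    (u : List Cand) : Bool :=
  consistent (T ++ u) && u.all fun x => lengthLE (supporters cands ballots u x) B

/-- Membership of a pair of candidates in a list of pairs. -/
def pairMem (W : List (Cand × Cand)) (b c : Cand) : Bool :=
  W.any fun w => nameEq w.1.1 b.1 && nameEq w.2.1 c.1

/-- Keep the pairs `(a, b)` that extend, for each party, to a valid triple `(a, b, c)` with `c` in
that party and `(b, c)` among the given pairs. -/
def refinePairs (cands : List Cand) (ballots : List (List Name)) (T : List Cand)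
    (B : List (List Name)) (W : List (Cand × Cand)) : List (Cand × Cand) :=
  W.filter fun w => cands.all fun r => cands.any fun c =>
    nameEq c.2 r.2 && pairMem W w.2 c && valid cands ballots T B [w.1, w.2, c]

/-- All pairs of candidates. -/
def allPairs (cands : List Cand) : List (Cand × Cand) :=
  cands.flatMap fun a => cands.map fun b => (a, b)

/-- Decision procedure for the Possible President problem: guess the nominees of the distinguished
party and of its neighbours, and test whether local extensions always exist. -/
def possible (I : Name × List Cand × List (List Name)) : Bool :=
  I.2.1.any fun x => nameEq x.2 I.1 && (tuples I.2.1 2).any fun t =>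
    consistent (x :: t) &&
      -- The list of candidates serves only as a counter of rounds; it is long enough because every
      -- party has a candidate.
      !(I.2.1.foldl
        (fun W _ => refinePairs I.2.1 I.2.2 (x :: t) (supporters I.2.1 I.2.2 (x :: t) x) W)
        (allPairs I.2.1)).isEmpty

/-- The effect of an input symbol, with the input read from the end, on the list of the lists of
names read so far. -/
def parseStep (s : Bool × Bool) (g : List (List Name)) : List (List Name) :=
  bif s.1 then ((s.2 :: g.headI.headI) :: g.headI.tail) :: g.tail
  else bif s.2 then ([] :: g.headI) :: g.tail else [] :: g

/-- Split the reversed input into lists of names. -/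
def parse (w : List (Bool × Bool)) : List (List Name) :=
  w.foldl (fun g s => parseStep s g) []

/-- Group the members of a list of even length into pairs. -/
def pairUp (l : List Name) : List Cand :=
  (l.foldr (fun x s => bif s.1.isEmpty then ([x], s.2) else ([], (x, s.1.headI) :: s.2))
    (([] : List Name), ([] : List Cand))).2

/-- Read off the distinguished party, the candidates and the ballots from the reversed input. -/
def decode (w : List (Bool × Bool)) : Name × List Cand × List (List Name) :=
  ((parse w).headI.headI, pairUp (parse w).headI.tail, (parse w).tail)

end President

/-! ### Polynomial running time of the algorithms -/

namespace PolyFun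

open President

@[fun_prop]
theorem before {l : α → List Name} {f g : α → Name} (hl : PolyFun l) (hf : PolyFun f)
    (hg : PolyFun g) : PolyFun fun x => before (l x) (f x) (g x) :=
  foldr (start := fun _ => false) (step := fun x b r =>
      bif _root_.nameEq b (g x) then false else bif _root_.nameEq b (f x) then true else r) hl
    (by fun_prop) (by fun_prop) ⟨3, fun x b _ s => (repSize_bool_le _).trans (by simp)⟩

@[fun_prop]
theorem consistent {S : α → List Cand} (hS : PolyFun S) : PolyFun fun x => consistent (S x) := by
  unfold President.consistent
  fun_prop

@[fun_prop]
theorem beats {S : α → List Cand} {c : α → Cand} {b : α → List Name} (hS : PolyFun S)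
    (hc : PolyFun c) (hb : PolyFun b) : PolyFun fun x => beats (S x) (c x) (b x) := by
  unfold President.beats
  fun_prop

@[fun_prop]
theorem supports {L S : α → List Cand} {c : α → Cand} {b : α → List Name} (hL : PolyFun L)
    (hS : PolyFun S) (hc : PolyFun c) (hb : PolyFun b) :
    PolyFun fun x => supports (L x) (S x) (c x) (b x) := by
  unfold President.supports
  fun_prop

@[fun_prop]
theorem supporters {L S : α → List Cand} {c : α → Cand} {b : α → List (List Name)}
    (hL : PolyFun L) (hb : PolyFun b) (hS : PolyFun S) (hc : PolyFun c) :
    PolyFun fun x => supporters (L x) (b x) (S x) (c x) := by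
  unfold President.supporters
  fun_prop

@[fun_prop]
theorem tuples {L : α → List Cand} (hL : PolyFun L) (n : ℕ) : PolyFun fun x => tuples (L x) n := by
  induction n with
  | zero => exact const _
  | succ n ih =>
    have h : ∀ T : α → List (List Cand), PolyFun T →
        PolyFun fun x => (L x).flatMap fun a => (T x).map fun t => a :: t :=
      fun T hT => by fun_prop
    exact h _ ih

theorem necessary : PolyFun necessary := by
  unfold President.necessary
  fun_prop

@[fun_prop]
theorem valid {L T u : α → List Cand} {b B : α → List (List Name)}
    (hL : PolyFun L) (hb : PolyFun b) (hT : PolyFun T) (hB : PolyFun B) (hu : PolyFun u) :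
    PolyFun fun x => valid (L x) (b x) (T x) (B x) (u x) := by
  unfold President.valid
  fun_prop

@[fun_prop]
theorem pairMem {W : α → List (Cand × Cand)} {b c : α → Cand}
    (hW : PolyFun W) (hb : PolyFun b) (hc : PolyFun c) :
    PolyFun fun x => pairMem (W x) (b x) (c x) := by
  unfold President.pairMem
  fun_prop

@[fun_prop]
theorem refinePairs {L T : α → List Cand} {b B : α → List (List Name)} {W : α → List (Cand × Cand)}
    (hL : PolyFun L) (hb : PolyFun b) (hT : PolyFun T) (hB : PolyFun B) (hW : PolyFun W) :
    PolyFun fun x => refinePairs (L x) (b x) (T x) (B x) (W x) := by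
  unfold President.refinePairs
  fun_prop

theorem repSize_filter_le (p : α → Bool) (l : List α) : repSize (l.filter p) ≤ repSize l := by
  induction l with
  | nil => simp
  | cons a l ih => cases h : p a <;> simp [h] <;> lia

@[fun_prop]
theorem foldl_refinePairs {K L T : α → List Cand} {b B : α → List (List Name)}
    {W : α → List (Cand × Cand)} (hK : PolyFun K) (hL : PolyFun L) (hb : PolyFun b)
    (hT : PolyFun T) (hB : PolyFun B) (hW : PolyFun W) :
    PolyFun fun x =>
      (K x).foldl (fun V _ => President.refinePairs (L x) (b x) (T x) (B x) V) (W x) :=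
  foldl (step := fun x V _ => President.refinePairs (L x) (b x) (T x) (B x) V) hK hW (by fun_prop)
    ⟨0, fun _ _ _ _ => (repSize_filter_le _ _).trans (Nat.le_add_right _ _)⟩

@[fun_prop]
theorem allPairs {L : α → List Cand} (hL : PolyFun L) : PolyFun fun x => allPairs (L x) := by
  unfold President.allPairs
  fun_prop

theorem possible : PolyFun possible := by
  unfold President.possible
  fun_prop

theorem repSize_parseStep_le (s : Bool × Bool) (g : List (List Name)) :
    repSize (parseStep s g) ≤ repSize g + 10 := by
  have h₁ := repSize_headI_add_tail_le g
  have h₂ := repSize_headI_add_tail_le g.headI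
  have h₃ := repSize_bool_le s.2
  unfold parseStep
  cases s.1
  · cases s.2 <;> simp <;> lia
  · simp only [cond_true, repSize_cons]
    lia

@[fun_prop]
theorem parse : PolyFun parse := by
  refine foldl (l := fun w => w) (start := fun _ => []) (step := fun _ g s => parseStep s g)
    (by fun_prop) (by fun_prop) ?_ ⟨10, fun x b _ s => ?_⟩
  · unfold parseStep
    fun_prop
  · simpa using repSize_parseStep_le b s

@[fun_prop]
theorem pairUp : PolyFun pairUp := by
  refine snd (foldr (l := fun w => w) (start := fun _ => (([] : List Name), ([] : List Cand)))
    (step := fun _ x s => bif s.1.isEmpty then ([x], s.2) else ([], (x, s.1.headI) :: s.2))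
    (by fun_prop) (by fun_prop) (by fun_prop) ⟨X + 10, fun l x hx s => ?_⟩)
  have h := repSize_le_of_mem hx
  have h' := repSize_headI_add_tail_le s.1
  simp only [eval_add, eval_X, eval_ofNat]
  cases s.1.isEmpty <;> simp only [cond_true, cond_false, repSize_prod, repSize_cons,
    repSize_nil] <;> lia

theorem decode : PolyFun decode := by
  unfold President.decode
  fun_prop

end PolyFun

end PolyFun

/-! ### Correctness of the algorithms -/

namespace Election

variable {C 𝓟 V : Type} (E : Election C 𝓟 V)

/-- No two different members of the list have the same party. -/
def Consistent (S : List C) : Prop := ∀ a ∈ S, ∀ b ∈ S, E.party a = E.party b → a = b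

/-- Voter `v` prefers `x` to all other members of `S`. -/
def Beats (S : List C) (v : V) (x : C) : Prop := ∀ d ∈ S, d = x ∨ E.prefers v x d

/-- Voter `v` prefers `x` to all other candidates that can be nominated together with `S`. -/
def Supports (S : List C) (v : V) (x : C) : Prop :=
  ∀ d, d = x ∨ ((∃ y ∈ S, E.party y = E.party d) ∧ d ∉ S) ∨ E.prefers v x d

/-- The nominees `u` are compatible with `T`, and none of them has more than `B` supporters. -/
def Valid (T : List C) (B : ℕ) (u : List C) : Prop :=
  E.Consistent (T ++ u) ∧ ∀ x ∈ u, {v | E.Supports u v x}.ncard ≤ B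

/-- The pair `(a, b)` can be extended `i` times by a candidate of any given party such that any
three consecutive candidates are valid. -/
def Extendable (T : List C) (B : ℕ) : ℕ → C → C → Prop
  | 0, _, _ => True
  | i + 1, a, b => Extendable T B i a b ∧
      ∀ r, ∃ c, E.party c = E.party r ∧ Extendable T B i b c ∧ E.Valid T B [a, b, c]

variable {E}

theorem Supports.votesFor {S : List C} {s : E.NominationScheme} {v : V} {Q : 𝓟}
    (hS : ∀ y ∈ S, s.1 (E.party y) = y) (h : E.Supports S v (s.1 Q)) : E.VotesFor s v Q := by
  intro R hR
  rcases h (s.1 R) with h | ⟨⟨y, hy, hyR⟩, h⟩ | h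
  · exact absurd (by rw [← s.2 R, h, s.2]) hR
  · rw [s.2] at hyR
    subst hyR
    rw [hS y hy] at h
    exact absurd hy h
  · exact h

theorem VotesFor.beats {S : List C} {s : E.NominationScheme} {v : V} {Q : 𝓟}
    (hS : ∀ y ∈ S, s.1 (E.party y) = y) (h : E.VotesFor s v Q) : E.Beats S v (s.1 Q) := by
  intro d hd
  by_cases hdQ : E.party d = Q
  · left
    rw [← hdQ, hS d hd]
  · right
    rw [← hS d hd]
    exact h _ hdQ

/-! ### Votes are decided by neighbouring parties -/

variable (E) in
/-- The enumeration `e` of the parties is an axis: of three candidates from different parties, no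
voter puts the middle one last. -/
def IsAxis {k : ℕ} (e : Fin k ≃ 𝓟) : Prop :=
  ∀ v a b c i j l, E.party a = e i → E.party b = e j → E.party c = e l → i < j → j < l →
    (E.prefers v a b → E.prefers v b c) ∧ (E.prefers v c b → E.prefers v b a)

/-- Each voter's axis orders candidates of different parties as the party axis does, by
compatibility and trichotomy. The second implication is the mirror image of single-peakedness: if it
failed, `a` would be preferred to `b`, hence `b` to `c`. -/
theorem PartyAlignedSinglePeaked.exists_isAxis [Finite 𝓟] (h : E.PartyAlignedSinglePeaked) :
    ∃ (k : ℕ) (e : Fin k ≃ 𝓟), E.IsAxis e := by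
  classical
  obtain ⟨partyAx, hP, h⟩ := h
  have : Fintype 𝓟 := Fintype.ofFinite 𝓟
  let : LinearOrder 𝓟 := linearOrderOfSTO partyAx
  let e : Fin (Fintype.card 𝓟) ≃o 𝓟 := monoEquivOfFin 𝓟 rfl
  refine ⟨_, e.toEquiv, ?_⟩
  intro v a b c i j l ha hb hc hij hjl
  obtain ⟨ax, hax, hsp, hcomp⟩ := h v
  have hpr := E.prefers_strict v
  have lt_ax : ∀ {a b i j}, E.party a = e i → E.party b = e j → i < j → ax a b := by
    intro a b i j ha hb hij
    have hlt : partyAx (E.party a) (E.party b) := by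
      rw [ha, hb]
      exact e.strictMono hij
    have hne : E.party a ≠ E.party b := fun h => hP.irrefl _ (h ▸ hlt)
    rcases trichotomous_of ax a b with h | h | h
    · exact h
    · exact absurd (congrArg _ h) hne
    · exact absurd (hP.trans _ _ _ hlt (hcomp b a hne.symm h)) (hP.irrefl _)
  have hab := lt_ax ha hb hij
  have hbc := lt_ax hb hc hjl
  refine ⟨hsp a b c hab hbc, fun hcb => ?_⟩
  rcases trichotomous_of (E.prefers v) b a with h | h | h
  · exact h
  · subst h
    exact absurd hab (hax.irrefl _)
  · exact absurd (hpr.trans _ _ _ hcb (hsp a b c hab hbc h)) (hpr.irrefl _)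

/-- A candidate `d` of a farther party is separated from party `j` by a neighbour. As the nominee of
`j` is preferred to that neighbour's nominee, the axis property puts the latter above `d`, and
transitivity finishes. In party `j` and the adjacent ones, a candidate outside `S` is excluded
because its party is already represented. -/
theorem IsAxis.supports {k : ℕ} {e : Fin k ≃ 𝓟} (he : E.IsAxis e) {v : V}
    {s : E.NominationScheme} {j : Fin k} {S : List C} (hS : E.Consistent S) (hj : s.1 (e j) ∈ S)
    (hn : ∀ i : Fin k, (i : ℕ) + 1 = j ∨ (j : ℕ) + 1 = i →
      s.1 (e i) ∈ S ∧ E.prefers v (s.1 (e j)) (s.1 (e i))) :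
    E.Supports S v (s.1 (e j)) := by
  have hpr := E.prefers_strict v
  intro d
  obtain ⟨i, hi⟩ := e.surjective (E.party d)
  have near : ∀ l, s.1 (e l) ∈ S → E.party d = e l →
      d = s.1 (e l) ∨ ((∃ y ∈ S, E.party y = E.party d) ∧ d ∉ S) := by
    intro l hl hdl
    by_cases hdS : d ∈ S
    · exact Or.inl (hS _ hdS _ hl (by rw [s.2, hdl]))
    · exact Or.inr ⟨⟨_, hl, by rw [s.2, hdl]⟩, hdS⟩
  have nbr : ∀ l : Fin k, (l : ℕ) + 1 = j ∨ (j : ℕ) + 1 = l → E.party d = e l →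
      ((∃ y ∈ S, E.party y = E.party d) ∧ d ∉ S) ∨ E.prefers v (s.1 (e j)) d := by
    intro l hl hdl
    obtain ⟨h₁, h₂⟩ := hn l hl
    rcases near l h₁ hdl with h | h
    · exact Or.inr (h ▸ h₂)
    · exact Or.inl h
  rcases lt_trichotomy i j with hij | hij | hij
  · right
    by_cases hij' : (i : ℕ) + 1 = j
    · exact nbr i (Or.inl hij') hi.symm
    · have hl : ((⟨j - 1, by lia⟩ : Fin k) : ℕ) + 1 = j := by simp only []; lia
      have h := (hn _ (Or.inl hl)).2
      exact Or.inr (hpr.trans _ _ _ h ((he v d _ _ i _ j hi.symm (s.2 _) (s.2 _)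
        (by rw [Fin.lt_def]; lia) (by rw [Fin.lt_def]; lia)).2 h))
  · subst hij
    exact (near i hj hi.symm).imp_right Or.inl
  · right
    by_cases hij' : (j : ℕ) + 1 = i
    · exact nbr i (Or.inr hij') hi.symm
    · have hl : (j : ℕ) + 1 = ((⟨j + 1, by lia⟩ : Fin k) : ℕ) := rfl
      have h := (hn _ (Or.inr hl)).2
      exact Or.inr (hpr.trans _ _ _ h ((he v _ _ d j _ i (s.2 _) (s.2 _) hi.symm
        (by rw [Fin.lt_def]; lia) (by rw [Fin.lt_def]; simp only []; lia)).1 h))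

theorem exists_neighbors {k : ℕ} (e : Fin k ≃ 𝓟) (s : E.NominationScheme) (j : Fin k) :
    ∃ t : List C, t.length = 2 ∧ (∀ y ∈ t, s.1 (E.party y) = y) ∧
      ∀ i : Fin k, (i : ℕ) + 1 = j ∨ (j : ℕ) + 1 = i → s.1 (e i) ∈ t := by
  have hs : ∀ P, s.1 (E.party (s.1 P)) = s.1 P := fun P => by rw [s.2]
  -- At either end of the axis the missing neighbour is replaced by the nominee of `j` itself; on
  -- the left, truncated subtraction does this. Repetitions do not affect consistency.
  refine ⟨[s.1 (e ⟨j - 1, by lia⟩),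
    if h : (j : ℕ) + 1 < k then s.1 (e ⟨j + 1, h⟩) else s.1 (e j)], rfl, ?_, ?_⟩
  · intro y hy
    simp only [List.mem_cons, List.not_mem_nil, or_false] at hy
    rcases hy with rfl | rfl
    · exact hs _
    · split_ifs
      · exact hs _
      · exact hs _
  · intro i hi
    rcases hi with hi | hi
    · have : i = ⟨j - 1, by lia⟩ := Fin.ext (by simp only []; lia)
      simp [this]
    · have h : (j : ℕ) + 1 < k := by lia
      have : i = ⟨j + 1, h⟩ := Fin.ext hi.symm
      simp [this, h]

theorem consistent_of_scheme {s : E.NominationScheme} {S : List C}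
    (hS : ∀ y ∈ S, s.1 (E.party y) = y) : E.Consistent S := by
  intro a ha b hb hab
  rw [← hS a ha, ← hS b hb, hab]

theorem Consistent.exists_scheme {S : List C} (hS : E.Consistent S) :
    ∃ s : E.NominationScheme, ∀ y ∈ S, s.1 (E.party y) = y := by
  classical
  refine ⟨⟨fun Q => if h : ∃ y ∈ S, E.party y = Q then h.choose else (E.party_surjective Q).choose,
    fun Q => ?_⟩, fun y hy => ?_⟩
  · beta_reduce
    split_ifs with h
    · exact h.choose_spec.2
    · exact (E.party_surjective Q).choose_spec
  · have h : ∃ z ∈ S, E.party z = E.party y := ⟨y, hy, rfl⟩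
    simp only [dif_pos h]
    exact hS _ h.choose_spec.1 _ hy h.choose_spec.2

theorem not_isNecessaryPresident_iff [Finite V] {k : ℕ} {e : Fin k ≃ 𝓟} (he : E.IsAxis e) (P : 𝓟) :
    ¬ E.IsNecessaryPresident P ↔ ∃ x, E.party x = P ∧ ∃ t : List C, t.length = 5 ∧
      E.Consistent (x :: t) ∧ ∃ y ∈ t,
        {v | E.Beats (x :: t) v x}.ncard < {v | E.Supports (x :: t) v y}.ncard := by
  constructor
  · intro h
    simp only [IsNecessaryPresident, IsWinner, not_forall, not_le] at h
    obtain ⟨s, Q, hlt⟩ := h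
    obtain ⟨i, rfl⟩ := e.surjective P
    obtain ⟨j, rfl⟩ := e.surjective Q
    obtain ⟨t₁, hl₁, hs₁, hn₁⟩ := exists_neighbors e s i
    obtain ⟨t₂, hl₂, hs₂, hn₂⟩ := exists_neighbors e s j
    have hsc : ∀ y ∈ s.1 (e i) :: (s.1 (e j) :: (t₁ ++ t₂)), s.1 (E.party y) = y := by
      intro y hy
      simp only [List.mem_cons, List.mem_append] at hy
      rcases hy with rfl | rfl | hy | hy
      · rw [s.2]
      · rw [s.2]
      · exact hs₁ y hy
      · exact hs₂ y hy
    have hcons := consistent_of_scheme hsc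
    refine ⟨s.1 (e i), s.2 _, s.1 (e j) :: (t₁ ++ t₂), by simp [hl₁, hl₂], hcons,
      s.1 (e j), by simp, ?_⟩
    -- Both neighbourhoods are in the list, so beating it makes `x` win the vote, and a vote for the
    -- rival is support for it.
    refine lt_of_le_of_lt (Set.ncard_le_ncard ?_ (Set.toFinite _))
      (lt_of_lt_of_le hlt (Set.ncard_le_ncard ?_ (Set.toFinite _)))
    · intro v hv
      refine Supports.votesFor hsc (he.supports hcons (by simp) fun l hl => ?_)
      have hmem : s.1 (e l) ∈ s.1 (e i) :: (s.1 (e j) :: (t₁ ++ t₂)) := by simp [hn₁ l hl]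
      refine ⟨hmem, (hv _ hmem).resolve_left fun h => ?_⟩
      have := congrArg E.party h
      rw [s.2, s.2] at this
      have := e.injective this
      subst this
      lia
    · intro v hv
      refine he.supports hcons (by simp) fun l hl => ⟨by simp [hn₂ l hl], hv _ fun h => ?_⟩
      have := e.injective h
      subst this
      lia
  · rintro ⟨x, rfl, t, -, hcons, y, hy, hlt⟩ h
    obtain ⟨s, hs⟩ := hcons.exists_scheme
    have hw := h s (E.party y)
    have h₁ : {v | E.Supports (x :: t) v y}.ncard ≤ E.score s (E.party y) := by
      refine Set.ncard_le_ncard (fun v hv => ?_) (Set.toFinite _)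
      refine Supports.votesFor hs ?_
      rwa [hs y (by simp [hy])]
    have h₂ : E.score s (E.party x) ≤ {v | E.Beats (x :: t) v x}.ncard := by
      refine Set.ncard_le_ncard (fun v hv => ?_) (Set.toFinite _)
      have := VotesFor.beats hs hv
      rwa [hs x (by simp)] at this
    lia

/-! ### Possible President: walks along an unknown axis -/

theorem Extendable.mono {T : List C} {B : ℕ} {i j : ℕ} {a b : C} (hij : i ≤ j)
    (h : E.Extendable T B j a b) : E.Extendable T B i a b := by
  induction j, hij using Nat.le_induction with
  | base => exact h
  | succ j _ ih => exact ih h.1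

/-- The sequence `f` of parties is arbitrary because each extension step quantifies over all
parties; this is where the true axis can be inserted afterwards. -/
theorem Extendable.exists_walk {T : List C} {B N : ℕ} : ∀ {a b : C} (_ : E.Extendable T B N a b)
    (f : ℕ → 𝓟), ∃ d : ℕ → C, d 0 = a ∧ d 1 = b ∧
      ∀ i < N, E.party (d (i + 2)) = f i ∧ E.Valid T B [d i, d (i + 1), d (i + 2)] := by
  induction N with
  | zero =>
    intro a b _ f
    exact ⟨fun i => if i = 0 then a else b, by simp, by simp, by simp⟩
  | succ N ih =>
    intro a b h f
    obtain ⟨r, hr⟩ := E.party_surjective (f 0)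
    obtain ⟨c, hc, hext, hval⟩ := h.2 r
    obtain ⟨d, h0, h1, hd⟩ := ih hext fun i => f (i + 1)
    refine ⟨fun i => Nat.casesOn i a d, rfl, h0, fun i hi => ?_⟩
    cases i with
    | zero =>
      simp only [h0, h1]
      exact ⟨hc.trans hr, hval⟩
    | succ i => exact hd i (by lia)

/-- Whatever party is requested, the scheme's nominee is a legal answer: supporters relative to any
three nominees do vote for the candidate in question, so there are at most `B` of them even if the
three parties are not adjacent. -/
theorem extendable_of_scheme [Finite V] {s : E.NominationScheme} {T : List C} {B : ℕ}
    (hT : ∀ y ∈ T, s.1 (E.party y) = y) (hB : ∀ Q, E.score s Q ≤ B) (i : ℕ) (Q R : 𝓟) :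
    E.Extendable T B i (s.1 Q) (s.1 R) := by
  induction i generalizing Q R with
  | zero => trivial
  | succ i ih =>
    refine ⟨ih Q R, fun r => ⟨s.1 (E.party r), s.2 _, ih _ _, ?_, ?_⟩⟩
    · refine consistent_of_scheme (s := s) fun y hy => ?_
      simp only [List.mem_append, List.mem_cons, List.not_mem_nil, or_false] at hy
      rcases hy with hy | rfl | rfl | rfl
      · exact hT y hy
      all_goals rw [s.2]
    · have key : ∀ Q', {v | E.Supports [s.1 Q, s.1 R, s.1 (E.party r)] v (s.1 Q')}.ncard ≤ B := by
        intro Q'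
        refine le_trans (Set.ncard_le_ncard (fun v hv => ?_) (Set.toFinite _)) (hB Q')
        refine Supports.votesFor (fun y hy => ?_) hv
        simp only [List.mem_cons, List.not_mem_nil, or_false] at hy
        rcases hy with rfl | rfl | rfl <;> rw [s.2]
      intro x hx
      simp only [List.mem_cons, List.not_mem_nil, or_false] at hx
      rcases hx with rfl | rfl | rfl <;> exact key _

theorem isPossiblePresident_iff [Finite V] {k n : ℕ} {e : Fin k ≃ 𝓟} (he : E.IsAxis e)
    (hkn : k ≤ n) (P : 𝓟) :
    E.IsPossiblePresident P ↔ ∃ x, E.party x = P ∧ ∃ t : List C, t.length = 2 ∧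
      E.Consistent (x :: t) ∧
        ∃ a b, E.Extendable (x :: t) {v | E.Supports (x :: t) v x}.ncard n a b := by
  constructor
  · rintro ⟨s, hw⟩
    obtain ⟨j, rfl⟩ := e.surjective P
    obtain ⟨t, hl, hs, hn⟩ := exists_neighbors e s j
    have hsc : ∀ y ∈ s.1 (e j) :: t, s.1 (E.party y) = y := by
      intro y hy
      rcases List.mem_cons.1 hy with rfl | hy
      · rw [s.2]
      · exact hs y hy
    have hcons := consistent_of_scheme hsc
    refine ⟨s.1 (e j), s.2 _, t, hl, hcons, s.1 (e j), s.1 (e j),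
      extendable_of_scheme hsc (fun Q => (hw Q).trans ?_) _ _ _⟩
    refine Set.ncard_le_ncard (fun v hv => ?_) (Set.toFinite _)
    refine he.supports hcons (by simp) fun l hl => ⟨by simp [hn l hl], hv _ fun h => ?_⟩
    have := e.injective h
    subst this
    lia
  · rintro ⟨x, rfl, t, -, hcons, a, b, hab⟩
    obtain ⟨d, -, -, hd⟩ := (hab.mono hkn).exists_walk
      fun i => if h : i < k then e ⟨i, h⟩ else E.party x
    have hparty : ∀ j : Fin k, E.party (d (j + 2)) = e j := fun j => by
      rw [(hd j j.2).1, dif_pos j.2]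
    -- The nominee of the party at position `j` is `d (j + 2)`; `d 0` and `d 1` are the starting
    -- pair and serve only as padding.
    let s : E.NominationScheme := ⟨fun Q => d (e.symm Q + 2), fun Q => by
      rw [hparty, e.apply_symm_apply]⟩
    have hse : ∀ j, s.1 (e j) = d (j + 2) := fun j => by simp [s]
    have hsT : ∀ y ∈ x :: t, s.1 (E.party y) = y := by
      intro y hy
      obtain ⟨j, hj⟩ := e.surjective (E.party y)
      refine (hd j j.2).2.1 _ ?_ y (List.mem_append_left _ hy) (s.2 _)
      rw [← hj, hse]
      simp
    refine ⟨s, fun Q => ?_⟩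
    obtain ⟨j, rfl⟩ := e.surjective Q
    have hle : ∀ u : List C, E.Valid (x :: t) {v | E.Supports (x :: t) v x}.ncard u →
        s.1 (e j) ∈ u →
        (∀ i : Fin k, (i : ℕ) + 1 = j ∨ (j : ℕ) + 1 = i → s.1 (e i) ∈ u) →
        E.score s (e j) ≤ {v | E.Supports (x :: t) v x}.ncard := by
      intro u hu hj hn
      refine le_trans (Set.ncard_le_ncard (fun v hv => ?_) (Set.toFinite _)) (hu.2 _ hj)
      refine he.supports (fun a ha b hb => hu.1 a (List.mem_append_right _ ha) b
        (List.mem_append_right _ hb)) hj fun l hl => ⟨hn l hl, hv _ fun h => ?_⟩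
      have := e.injective h
      subst this
      lia
    have hB : E.score s (e j) ≤ {v | E.Supports (x :: t) v x}.ncard := by
      -- If a right neighbour exists, the triple centred at `j` contains all neighbours, with
      -- padding on the left when `j = 0`. For the last party, the triple ending at `j` is used.
      by_cases hjk : (j : ℕ) + 1 < k
      · refine hle _ (hd (j + 1) hjk).2 (by simp [hse]) fun i hi => ?_
        rw [hse]
        rcases hi with hi | hi
        · simp [← hi]
        · simp [← hi]
      · refine hle _ (hd j j.2).2 (by simp [hse]) fun i hi => ?_
        rw [hse]
        rcases hi with hi | hi
        · simp [← hi]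
        · lia
    refine hB.trans (Set.ncard_le_ncard (fun v hv => ?_) (Set.toFinite _))
    refine Supports.votesFor hsT ?_
    rwa [hsT x (by simp)]

end Election

/-! ### From encoded inputs to elections -/

namespace PresidentInput

open Computability President

theorem encodeNat_injective : Function.Injective encodeNat := fun a b h => by
  rw [← decode_encodeNat a, h, decode_encodeNat]

/-! #### Reading the input -/

/-- The effect of a part of the input, read from the end. -/
def parseFrom (w : List Γ') (g : List (List Name)) : List (List Name) :=
  w.foldr (fun c g => parseStep (symbolCode c) g) g

theorem parse_reverse (w : List Γ') : parse (w.reverse.map symbolCode) = parseFrom w [] := by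
  rw [parse, parseFrom, List.map_reverse, List.foldl_reverse, List.foldr_map]

theorem parseFrom_append (w w' : List Γ') (g : List (List Name)) :
    parseFrom (w ++ w') g = parseFrom w (parseFrom w' g) := List.foldr_append

theorem parseFrom_bits (l : List Bool) (x : Name) (h : List Name) (g : List (List Name)) :
    parseFrom (l.map inclusionBoolΓ') ((x :: h) :: g) = ((l ++ x) :: h) :: g := by
  induction l with
  | nil => rfl
  | cons b l ih =>
    simp only [parseFrom, List.map_cons, List.foldr_cons] at ih ⊢
    rw [ih]
    rfl

/-- Read from the end, the comma opens an empty name, and the bits are then prepended in their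
original order. -/
theorem parseFrom_encodeNumber (m : ℕ) (h : List Name) (g : List (List Name)) :
    parseFrom (encodeNumber m) (h :: g) = (encodeNat m :: h) :: g := by
  have := parseFrom_bits (encodeNat m) [] h g
  rw [List.append_nil] at this
  rw [encodeNumber, parseFrom_append]
  exact this

theorem parseFrom_flatMap_encodeNumber {ι : Type} (f : ι → ℕ) (l : List ι) (h : List Name)
    (g : List (List Name)) : parseFrom (l.flatMap fun i => encodeNumber (f i)) (h :: g) =
      (l.map (fun i => encodeNat (f i)) ++ h) :: g := by
  induction l with
  | nil => rfl
  | cons i l ih =>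
    rw [List.flatMap_cons, parseFrom_append, ih, parseFrom_encodeNumber]
    rfl

theorem parseFrom_flatMap_pairs {ι : Type} (f f' : ι → ℕ) (l : List ι) (h : List Name)
    (g : List (List Name)) :
    parseFrom (l.flatMap fun i => encodeNumber (f i) ++ encodeNumber (f' i)) (h :: g) =
      ((l.flatMap fun i => [encodeNat (f i), encodeNat (f' i)]) ++ h) :: g := by
  induction l with
  | nil => rfl
  | cons i l ih =>
    rw [List.flatMap_cons, parseFrom_append, ih, parseFrom_append, parseFrom_encodeNumber,
      parseFrom_encodeNumber]
    rfl

theorem parseFrom_ballots {ι κ : Type} (f : κ → ι → ℕ) (l : List ι) (m : List κ)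
    (g : List (List Name)) :
    parseFrom (m.flatMap fun v => (l.flatMap fun i => encodeNumber (f v i)) ++ [Γ'.ket]) g =
      (m.map fun v => l.map fun i => encodeNat (f v i)) ++ g := by
  induction m with
  | nil => rfl
  | cons v m ih =>
    rw [List.flatMap_cons, parseFrom_append, ih, parseFrom_append]
    refine (parseFrom_flatMap_encodeNumber _ _ [] _).trans ?_
    simp

theorem pairUp_flatMap {ι : Type} (f f' : ι → Name) (l : List ι) :
    pairUp (l.flatMap fun i => [f i, f' i]) = l.map fun i => (f i, f' i) := by
  have key : ((l.flatMap fun i => [f i, f' i]).foldr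
      (fun x s => bif s.1.isEmpty then ([x], s.2) else ([], (x, s.1.headI) :: s.2))
      (([] : List Name), ([] : List Cand))) = ([], l.map fun i => (f i, f' i)) := by
    induction l with
    | nil => rfl
    | cons i l ih => simp [ih]
  rw [pairUp, key]

variable (I : PresidentInput)

/-- The name of a candidate together with the name of its party. -/
def cand (c : Fin I.numCandidates) : Cand := (encodeNat c, encodeNat (I.party c))

/-- The ballot of a voter as a list of names. -/
def ballotNames (v : Fin I.numVoters) : List Name :=
  (List.finRange I.numCandidates).map fun i => encodeNat (I.ballot v i)

theorem decode_encode : decode (I.encode.reverse.map symbolCode) =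
    (encodeNat I.distinguished, (List.finRange I.numCandidates).map I.cand,
      (List.finRange I.numVoters).map I.ballotNames) := by
  have h : parse (I.encode.reverse.map symbolCode) =
      (encodeNat I.distinguished :: (List.finRange I.numCandidates).flatMap
        fun c : Fin I.numCandidates => [encodeNat c, encodeNat (I.party c)]) ::
          (List.finRange I.numVoters).map I.ballotNames := by
    rw [parse_reverse, encode, parseFrom_append, parseFrom_append, parseFrom_append,
      parseFrom_ballots]
    refine (congrArg _ (parseFrom_flatMap_pairs _ _ _ [] _)).trans ?_
    rw [parseFrom_encodeNumber]
    simp [ballotNames]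
  rw [decode, h]
  simp only [List.headI, List.tail, pairUp_flatMap]
  rfl

/-! #### The meaning of the elementary tests -/

/-- A name missing from the list has index equal to its length, which agrees with the default
`false`. -/
theorem before_eq (l : List Name) (a b : Name) :
    before l a b = decide (l.idxOf a < l.idxOf b) := by
  unfold before
  induction l with
  | nil => simp
  | cons x l ih =>
    rw [List.foldr_cons, ih]
    by_cases hb : x = b
    · subst hb
      simp [nameEq_iff.2 rfl]
    · have hb' : nameEq x b = false := by
        rw [← Bool.not_eq_true, nameEq_iff]
        exact hb
      by_cases ha : x = a
      · subst ha
        simp [hb', nameEq_iff.2 rfl, List.idxOf_cons_ne _ hb]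
      · have ha' : nameEq x a = false := by
          rw [← Bool.not_eq_true, nameEq_iff]
          exact ha
        simp [hb', ha', List.idxOf_cons_ne _ hb, List.idxOf_cons_ne _ ha]

theorem idxOf_ballotNames (v : Fin I.numVoters) (a : Fin I.numCandidates) :
    (I.ballotNames v).idxOf (encodeNat a) = (I.ballot v).symm a := by
  have hnd : (I.ballotNames v).Nodup := by
    refine (List.nodup_finRange _).map fun i j h => ?_
    exact (I.ballot v).injective (Fin.ext (encodeNat_injective h))
  have hlt : ((I.ballot v).symm a : ℕ) < (I.ballotNames v).length := by simp [ballotNames]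
  have h := hnd.idxOf_getElem _ hlt
  have h' : (I.ballotNames v)[((I.ballot v).symm a : ℕ)] = encodeNat a := by simp [ballotNames]
  rwa [h'] at h

theorem before_ballotNames (v : Fin I.numVoters) (a b : Fin I.numCandidates) :
    before (I.ballotNames v) (encodeNat a) (encodeNat b) = true ↔ I.election.prefers v a b := by
  rw [before_eq, idxOf_ballotNames, idxOf_ballotNames, decide_eq_true_iff]
  exact Fin.lt_def.symm

theorem nameEq_encodeNat {n : ℕ} {a b : Fin n} :
    nameEq (encodeNat a) (encodeNat b) = true ↔ a = b := by
  rw [nameEq_iff, encodeNat_injective.eq_iff, Fin.ext_iff]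

theorem nameEq_cand_fst {a b : Fin I.numCandidates} :
    nameEq (I.cand a).1 (I.cand b).1 = true ↔ a = b := nameEq_encodeNat

theorem nameEq_cand_snd {a b : Fin I.numCandidates} :
    nameEq (I.cand a).2 (I.cand b).2 = true ↔ I.election.party a = I.election.party b :=
  nameEq_encodeNat

theorem before_cand {v : Fin I.numVoters} {a b : Fin I.numCandidates} :
    before (I.ballotNames v) (I.cand a).1 (I.cand b).1 = true ↔ I.election.prefers v a b :=
  I.before_ballotNames v a b

theorem consistent_map_cand {S : List (Fin I.numCandidates)} :
    consistent (S.map I.cand) = true ↔ I.election.Consistent S := by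
  simp only [consistent, List.all_map, List.all_eq_true, Function.comp_apply, Bool.or_eq_true,
    Bool.not_eq_true', ← Bool.not_eq_true, nameEq_cand_fst, nameEq_cand_snd, Election.Consistent,
    imp_iff_not_or]

theorem beats_map_cand {S : List (Fin I.numCandidates)} {x : Fin I.numCandidates}
    {v : Fin I.numVoters} :
    beats (S.map I.cand) (I.cand x) (I.ballotNames v) = true ↔ I.election.Beats S v x := by
  simp only [beats, List.all_map, List.all_eq_true, Function.comp_apply, Bool.or_eq_true,
    nameEq_cand_fst, before_cand, Election.Beats]

theorem supports_map_cand {S : List (Fin I.numCandidates)} {x : Fin I.numCandidates}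
    {v : Fin I.numVoters} :
    supports ((List.finRange I.numCandidates).map I.cand) (S.map I.cand) (I.cand x)
      (I.ballotNames v) = true ↔ I.election.Supports S v x := by
  simp only [supports, List.all_map, List.all_eq_true, Function.comp_apply, Bool.or_eq_true,
    Bool.and_eq_true, Bool.not_eq_true', ← Bool.not_eq_true, List.any_map, List.any_eq_true,
    nameEq_cand_fst, nameEq_cand_snd, before_cand, Election.Supports, List.mem_finRange,
    forall_true_left, or_assoc, exists_eq_right]

/-- The list of ballots is indexed by the voters and keeps repetitions, so voters with identical
ballots are counted separately. -/
theorem length_filter_ballots (p : List Name → Bool) :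
    (((List.finRange I.numVoters).map I.ballotNames).filter p).length =
      {v | p (I.ballotNames v) = true}.ncard := by
  rw [List.filter_map, List.length_map, Set.ncard_eq_toFinset_card']
  rw [← List.toFinset_card_of_nodup ((List.nodup_finRange _).filter _)]
  congr 1
  ext v
  simp

theorem length_supporters {S : List (Fin I.numCandidates)} {x : Fin I.numCandidates} :
    (supporters ((List.finRange I.numCandidates).map I.cand)
      ((List.finRange I.numVoters).map I.ballotNames) (S.map I.cand) (I.cand x)).length =
      {v | I.election.Supports S v x}.ncard := by
  rw [supporters, length_filter_ballots]
  simp only [supports_map_cand]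

theorem length_filter_beats {S : List (Fin I.numCandidates)} {x : Fin I.numCandidates} :
    (((List.finRange I.numVoters).map I.ballotNames).filter
      (beats (S.map I.cand) (I.cand x))).length = {v | I.election.Beats S v x}.ncard := by
  rw [length_filter_ballots]
  simp only [beats_map_cand]

/-! ### The algorithms decide the two problems -/

theorem any_tuples_map {ι : Type} {L : List ι} {f : ι → Cand} {n : ℕ} {p : List Cand → Bool} :
    (tuples (L.map f) n).any p = true ↔
      ∃ t : List ι, t.length = n ∧ (∀ x ∈ t, x ∈ L) ∧ p (t.map f) = true := by
  induction n generalizing p with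
  | zero =>
    simp only [tuples, List.any_cons, List.any_nil, Bool.or_false, List.length_eq_zero_iff]
    constructor
    · exact fun h => ⟨[], rfl, by simp, h⟩
    · rintro ⟨t, rfl, -, h⟩
      exact h
  | succ n ih =>
    simp only [tuples, List.any_flatMap, List.any_map]
    rw [List.any_eq_true]
    constructor
    · rintro ⟨a, ha, h⟩
      obtain ⟨t, hl, ht, hp⟩ := ih.1 h
      exact ⟨a :: t, by simp [hl], by simpa using ⟨ha, ht⟩, hp⟩
    · rintro ⟨t, hl, ht, hp⟩
      cases t with
      | nil => simp at hl
      | cons a t =>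
        refine ⟨a, ht a (by simp), ih.2 ⟨t, by simpa using hl, fun x hx => ht x (by simp [hx]), hp⟩⟩

theorem necessary_decode (hI : I.election.PartyAlignedSinglePeaked) :
    necessary (decode (I.encode.reverse.map symbolCode)) = true ↔
      I.election.IsNecessaryPresident I.distinguished := by
  obtain ⟨k, e, he⟩ := hI.exists_isAxis
  rw [← not_iff_not, Election.not_isNecessaryPresident_iff he, decode_encode, necessary,
    Bool.not_eq_true', Bool.not_eq_false, List.any_map, List.any_eq_true]
  simp only [List.mem_finRange, true_and, Function.comp_apply, Bool.and_eq_true, any_tuples_map,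
    implies_true]
  refine exists_congr fun x => and_congr nameEq_encodeNat (exists_congr fun t =>
    and_congr Iff.rfl ?_)
  rw [← List.map_cons, consistent_map_cand, List.any_map, List.any_eq_true]
  refine and_congr Iff.rfl (exists_congr fun y => and_congr Iff.rfl ?_)
  rw [Function.comp_apply, Bool.not_eq_true', ← Bool.not_eq_true, lengthLE_iff, not_le,
    length_supporters, length_filter_beats]

theorem valid_map_cand {T u : List (Fin I.numCandidates)} {B : List (List Name)} :
    valid ((List.finRange I.numCandidates).map I.cand)
      ((List.finRange I.numVoters).map I.ballotNames) (T.map I.cand) B (u.map I.cand) = true ↔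
      I.election.Valid T B.length u := by
  rw [valid, ← List.map_append, Bool.and_eq_true, consistent_map_cand, List.all_map,
    List.all_eq_true]
  simp only [Function.comp_apply, lengthLE_iff, length_supporters, Election.Valid]

/-- Stated for an arbitrary relation `R`: with level `i` of `Extendable` for `R`, the right side
unfolds to level `i + 1`, so each round of the fold raises the level by one. -/
theorem mem_refinePairs {T : List (Fin I.numCandidates)} {B : List (List Name)}
    {R : Fin I.numCandidates → Fin I.numCandidates → Prop} {W : List (Cand × Cand)}
    (hW : ∀ w, w ∈ W ↔ ∃ a b, w = (I.cand a, I.cand b) ∧ R a b) (w : Cand × Cand) :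
    w ∈ refinePairs ((List.finRange I.numCandidates).map I.cand)
      ((List.finRange I.numVoters).map I.ballotNames) (T.map I.cand) B W ↔
      ∃ a b, w = (I.cand a, I.cand b) ∧ R a b ∧ ∀ r, ∃ c, I.election.party c = I.election.party r ∧
        R b c ∧ I.election.Valid T B.length [a, b, c] := by
  have hmem : ∀ b c, pairMem W (I.cand b) (I.cand c) = true ↔ R b c := by
    intro b c
    simp only [pairMem, List.any_eq_true, Bool.and_eq_true]
    constructor
    · rintro ⟨w, hw, h₁, h₂⟩
      obtain ⟨a', b', rfl, hR⟩ := (hW w).1 hw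
      rw [nameEq_cand_fst] at h₁ h₂
      subst h₁ h₂
      exact hR
    · intro h
      exact ⟨_, (hW _).2 ⟨b, c, rfl, h⟩, I.nameEq_cand_fst.2 rfl, I.nameEq_cand_fst.2 rfl⟩
  have key : ∀ a b, ((((List.finRange I.numCandidates).map I.cand).all fun r =>
      ((List.finRange I.numCandidates).map I.cand).any fun c =>
        nameEq c.2 r.2 && pairMem W (I.cand b) c &&
          valid ((List.finRange I.numCandidates).map I.cand)
            ((List.finRange I.numVoters).map I.ballotNames) (T.map I.cand) B
            [I.cand a, I.cand b, c]) = true ↔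
      ∀ r, ∃ c, I.election.party c = I.election.party r ∧
        R b c ∧ I.election.Valid T B.length [a, b, c]) := by
    intro a b
    simp only [List.all_map, List.all_eq_true, List.any_map, List.any_eq_true, List.mem_finRange,
      forall_true_left, true_and, Function.comp_apply, Bool.and_eq_true, nameEq_cand_snd, hmem,
      and_assoc]
    refine forall_congr' fun r => exists_congr fun c => and_congr Iff.rfl (and_congr Iff.rfl ?_)
    exact I.valid_map_cand (u := [a, b, c])
  rw [refinePairs, List.mem_filter, hW]
  constructor
  · rintro ⟨⟨a, b, rfl, hR⟩, h⟩
    exact ⟨a, b, rfl, hR, (key a b).1 h⟩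
  · rintro ⟨a, b, rfl, hR, h⟩
    exact ⟨⟨a, b, rfl, hR⟩, (key a b).2 h⟩

theorem mem_foldl_refinePairs {ι : Type} {T : List (Fin I.numCandidates)} {B : List (List Name)}
    {W : List (Cand × Cand)} {i : ℕ}
    (hW : ∀ w, w ∈ W ↔ ∃ a b, w = (I.cand a, I.cand b) ∧ I.election.Extendable T B.length i a b)
    (L : List ι) (w : Cand × Cand) :
    w ∈ L.foldl (fun W _ => refinePairs ((List.finRange I.numCandidates).map I.cand)
      ((List.finRange I.numVoters).map I.ballotNames) (T.map I.cand) B W) W ↔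
      ∃ a b, w = (I.cand a, I.cand b) ∧
        I.election.Extendable T B.length (i + L.length) a b := by
  induction L generalizing W i with
  | nil => exact hW w
  | cons _ L ih =>
    rw [List.foldl_cons, ih (i := i + 1) (I.mem_refinePairs hW), List.length_cons]
    rw [add_assoc, add_comm 1]

theorem mem_allPairs (w : Cand × Cand) : w ∈ allPairs ((List.finRange I.numCandidates).map I.cand) ↔
    ∃ a b, w = (I.cand a, I.cand b) := by
  simp only [allPairs, List.mem_flatMap, List.mem_map, List.mem_finRange, true_and,
    exists_exists_eq_and]
  exact exists_congr fun a => exists_congr fun b => eq_comm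

theorem possible_decode (hI : I.election.PartyAlignedSinglePeaked) :
    possible (decode (I.encode.reverse.map symbolCode)) = true ↔
      I.election.IsPossiblePresident I.distinguished := by
  obtain ⟨k, e, he⟩ := hI.exists_isAxis
  have hk : k ≤ I.numCandidates := by
    have h := Fintype.card_le_of_surjective _ I.party_surjective
    rw [← Fintype.card_congr e] at h
    simpa using h
  rw [Election.isPossiblePresident_iff he hk, decode_encode, possible, List.any_map,
    List.any_eq_true]
  simp only [List.mem_finRange, true_and, Function.comp_apply, Bool.and_eq_true, any_tuples_map,
    implies_true]
  refine exists_congr fun x => and_congr nameEq_encodeNat (exists_congr fun t =>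
    and_congr Iff.rfl ?_)
  rw [← List.map_cons, consistent_map_cand]
  refine and_congr Iff.rfl ?_
  rw [Bool.not_eq_true', ← Bool.not_eq_true, List.isEmpty_iff, ← ne_eq]
  have h := I.mem_foldl_refinePairs (T := x :: t) (B := supporters
    ((List.finRange I.numCandidates).map I.cand) ((List.finRange I.numVoters).map I.ballotNames)
      ((x :: t).map I.cand) (I.cand x)) (i := 0)
    (W := allPairs ((List.finRange I.numCandidates).map I.cand))
    -- Level zero of `Extendable` is trivially true, so the iteration starts from all pairs.
    (fun w => by simp [mem_allPairs, Election.Extendable])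
    ((List.finRange I.numCandidates).map I.cand)
  simp only [length_supporters, List.length_map, List.length_finRange, zero_add] at h
  constructor
  · intro hne
    obtain ⟨w, hw⟩ := List.exists_mem_of_ne_nil _ hne
    obtain ⟨a, b, -, hab⟩ := (h w).1 hw
    exact ⟨a, b, hab⟩
  · rintro ⟨a, b, hab⟩
    exact List.ne_nil_of_mem ((h _).2 ⟨a, b, rfl, hab⟩)

end PresidentInput

theorem mainTheorem4 :
    PolyTimeSolvableOn PresidentInput.encode
        (fun I => I.election.PartyAlignedSinglePeaked)
        (fun I => I.election.IsPossiblePresident I.distinguished) ∧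
      PolyTimeSolvableOn PresidentInput.encode
        (fun I => I.election.PartyAlignedSinglePeaked)
        (fun I => I.election.IsNecessaryPresident I.distinguished) :=
  ⟨⟨_, fun I => I.1.possible_decode I.2,
      (PolyFun.possible.comp PolyFun.decode).tm2ComputableInPolyTime _⟩,
    ⟨_, fun I => I.1.necessary_decode I.2,
      (PolyFun.necessary.comp PolyFun.decode).tm2ComputableInPolyTime _⟩⟩
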